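/- Let $\triangle\subset\mathbb C$ be the open unit disk. For a complex manifold $X$ and $(x,v)\in TX$ let $$\omega^X_K(x,v):=\inf\Big\{\tfrac1\lambda : \lambda>0,\ f:\triangle\to X \text{ holomorphic},\ f(0)=x,\ df(0)(1)=\lambda v\Big\}$$ (the infinitesimal Kobayashi metric), and let $$\omega^X_\iota(x,v):=\inf\Big\{\tfrac1\lambda : \lambda>0,\ f:\triangle\to X \text{ holomorphic and injective},\ f(0)=x,\ df(0)(1)=\lambda v\Big\}$$ (the injective Kobayashi metric). A Riemann surface is called hyperbolic if its universal covering is biholomorphic to $\triangle$. **Theorem (Jarnicki).** Let $Y_1$ and $Y_2$ be compact (connected) hyperbolic Riemann surfaces and let $X:=Y_1\times Y_2$. Then $\omega^X_K\neq\omega^X_\iota$ as functions on $TX$, i.e. there is $(x,v)\in TX$ with $\omega^X_K(x,v)\neq\omega^X_\iota(x,v)$. -/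

import Mathlib

open scoped Manifold ContDiff ENNReal

noncomputable section

/-- The values `1/λ`, `λ > 0`, for which some holomorphic map `f` from the unit disc to the complex
manifold `X`, satisfying the extra condition `P`, has `f(0) = x` and `df(0)(1) = λ v`, where
`p = (x, v)` is a point of the tangent bundle `TX`. A map on the disc is represented by a function
on `ℂ` whose values outside the disc are irrelevant. -/
def discValues {E H X : Type*} [NormedAddCommGroup E] [NormedSpace ℂ E] [TopologicalSpace H]
    (I : ModelWithCorners ℂ E H) [TopologicalSpace X] [ChartedSpace H X]
    (P : (ℂ → X) → Prop) (p : TangentBundle I X) : Set ℝ≥0∞ :=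
  {r | ∃ (l : ℝ) (f : ℂ → X), 0 < l ∧ MDifferentiableOn 𝓘(ℂ, ℂ) I f (Metric.ball 0 1) ∧ P f ∧
    tangentMap 𝓘(ℂ, ℂ) I f ⟨0, (1 : ℂ)⟩ = ⟨p.1, (l : ℂ) • p.2⟩ ∧ r = ENNReal.ofReal (1 / l)}

/-- The infinitesimal Kobayashi metric of a complex manifold. The infimum is taken in `[0, ∞]`. -/
def kobayashiMetric {E H : Type*} [NormedAddCommGroup E] [NormedSpace ℂ E] [TopologicalSpace H]
    (I : ModelWithCorners ℂ E H) (X : Type*) [TopologicalSpace X] [ChartedSpace H X] :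
    TangentBundle I X → ℝ≥0∞ :=
  fun p => sInf (discValues I (fun _ => True) p)

/-- The injective Kobayashi metric of a complex manifold: only injective discs compete. -/
def injectiveKobayashiMetric {E H : Type*} [NormedAddCommGroup E] [NormedSpace ℂ E]
    [TopologicalSpace H] (I : ModelWithCorners ℂ E H)
    (X : Type*) [TopologicalSpace X] [ChartedSpace H X] : TangentBundle I X → ℝ≥0∞ :=
  fun p => sInf (discValues I (fun f => Set.InjOn f (Metric.ball 0 1)) p)

/-- A Riemann surface is hyperbolic if its universal covering is the unit disc, i.e. if there is a
surjective holomorphic covering map from the unit disc onto it. -/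
def IsHyperbolicRiemannSurface (Y : Type*) [TopologicalSpace Y] [ChartedSpace ℂ Y] : Prop :=
  ∃ π : ℂ → Y, MDifferentiableOn 𝓘(ℂ, ℂ) 𝓘(ℂ, ℂ) π (Metric.ball 0 1) ∧
    Set.SurjOn π (Metric.ball 0 1) Set.univ ∧ IsCoveringMap ((Metric.ball (0 : ℂ) 1).domRestrict π)

end

/-! Let `P₁`, `P₂` be universal coverings of the two factors by the disc with `P₁ 0 = P₁ r` and `P₂
0 = P₂ r` for one common `0 < r < 1`, such that the two branches of `(P₁, P₂)` at the double point
cross transversally. This disc shows that the Kobayashi metric of its own tangent vector at `0` is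
at most `1`. A competitor with `l` close to `1` lifts to a pair `(g, k)` of self-maps of the disc
fixing `0` with derivative `l`. By Schwarz and Borel–Carathéodory both are close to the identity on
a disc containing `0` and `r`. A transversal crossing in complex dimension two survives small
perturbations, so the competitor is not injective. Hence injective discs have `l < 1 - δ`, and the
injective metric exceeds `1` at this vector (`IsDiscCover.exists_pos_forall_not_injOn`).

It remains to find such coverings. Compactness forces a nontrivial deck transformation, a Möbius map
without fixed points in the disc. Moving the base point towards a boundary point that is not fixed
realizes every `r` close to `1` (`exists_discMoebius_pair`), so both factors can share `r`.
Transversality means that the ratios `q` of the derivatives at `0` and `r` differ. If they agree,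
precomposing one covering with the involution exchanging `0` and `r` replaces `q` by `(1 - r²)² /
q`, which differs from `q` because the base point was chosen with `q² ≠ (1 - r²)²`. -/

/-! ### One-variable estimates and persistence of a transversal crossing -/

-- If the derivative vanished, `f - f a` would be `ψ ^ n` with `n ≥ 2` and `ψ` a local coordinate,
-- so points with `ψ = t` and `ψ = ζ t`, for `ζ` a primitive `n`-th root of unity, would have the
-- same image.
open Metric Set Filter Topology in
theorem AnalyticAt.deriv_ne_zero_of_injOn {f : ℂ → ℂ} {a : ℂ} {U : Set ℂ}
    (hf : AnalyticAt ℂ f a) (hU : U ∈ 𝓝 a) (hinj : InjOn f U) : deriv f a ≠ 0 := by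
  intro hd
  have hfa : AnalyticAt ℂ (fun z => f z - f a) a := hf.sub analyticAt_const
  have hord : analyticOrderAt (fun z => f z - f a) a ≠ ⊤ := by
    rw [Ne, analyticOrderAt_eq_top]
    intro h
    have h0 : ∀ᶠ z in 𝓝 a, z ∈ U ∧ f z - f a = 0 := by
      filter_upwards [h, hU] with z hz hz' using ⟨hz', hz⟩
    have h1 : ∀ᶠ z in 𝓝[≠] a, z ∈ U ∧ f z - f a = 0 := h0.filter_mono nhdsWithin_le_nhds
    obtain ⟨z, ⟨hz, hz'⟩, hza⟩ := (h1.and self_mem_nhdsWithin).exists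
    exact hza (hinj hz (mem_of_mem_nhds hU) (sub_eq_zero.1 hz'))
  obtain ⟨h, hh, hha, hfh⟩ := (hfa.analyticOrderAt_ne_top).1 hord
  set n := analyticOrderNatAt (fun z => f z - f a) a with hn
  have hn2 : 2 ≤ n := by
    by_contra! hlt
    interval_cases hnn : n
    · have := hfh.self_of_nhds
      simp at this
      exact hha this.symm
    · have h1 : HasDerivAt (fun z => f z - f a) (h a) a := by
        have h2 : HasDerivAt (fun z => (z - a) * h z) (1 * h a + (a - a) * deriv h a) a :=
          ((hasDerivAt_id a).sub_const a).mul hh.differentiableAt.hasDerivAt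
        refine HasDerivAt.congr_of_eventuallyEq (by simpa using h2) ?_
        filter_upwards [hfh] with z hz
        simpa using hz
      have h3 : HasDerivAt (fun z => f z - f a) (deriv f a) a :=
        hf.differentiableAt.hasDerivAt.sub_const _
      exact hha (by rw [h1.unique h3, hd])
  have hn0 : n ≠ 0 := by omega
  obtain ⟨s, hs⟩ := IsAlgClosed.exists_pow_nat_eq (h a) (Nat.pos_of_ne_zero hn0)
  have hs0 : s ≠ 0 := by
    rintro rfl
    rw [zero_pow hn0] at hs
    exact hha hs.symm
  -- Dividing by `h a` puts the base of the principal power near `1`, away from the branch cut; `s`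
  -- restores the factor.
  set u : ℂ → ℂ := fun z => s * (h z / h a) ^ ((n : ℂ)⁻¹) with hu
  have hua : AnalyticAt ℂ u a := by
    refine analyticAt_const.mul ((hh.div analyticAt_const hha).cpow analyticAt_const ?_)
    simp [hha]
  have hun : ∀ z, u z ^ n = h z := by
    intro z
    simp only [hu, mul_pow, hs]
    rw [Complex.cpow_nat_inv_pow _ hn0]
    field_simp
  have hu0 : u a ≠ 0 := by
    intro h0
    have := hun a
    rw [h0, zero_pow hn0] at this
    exact hha this.symm
  set ψ : ℂ → ℂ := fun z => (z - a) * u z with hψ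
  have hψd : HasStrictDerivAt ψ (u a) a := by
    have h1 : HasStrictDerivAt (fun z : ℂ => z - a) 1 a := (hasStrictDerivAt_id a).sub_const a
    simpa [hψ] using h1.fun_mul hua.hasStrictDerivAt
  have hmap := hψd.map_nhds_eq hu0
  have hψa : ψ a = 0 := by simp [hψ]
  rw [hψa] at hmap
  set W : Set ℂ := {z | z ∈ U ∧ f z - f a = ψ z ^ n} with hW
  have hWn : W ∈ 𝓝 a := by
    filter_upwards [hU, hfh] with z hz hz'
    refine ⟨hz, ?_⟩
    rw [hz']
    simp [hψ, mul_pow, hun]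
  have hI : ψ '' W ∈ 𝓝 (0 : ℂ) := by
    rw [← hmap]
    exact image_mem_map hWn
  obtain ⟨ε, hε, hball⟩ := Metric.mem_nhds_iff.1 hI
  set ζ := Complex.exp (2 * Real.pi * Complex.I / n) with hζ
  have hprim : IsPrimitiveRoot ζ n := Complex.isPrimitiveRoot_exp n hn0
  have hζ1 : ζ ≠ 1 := hprim.ne_one (by omega)
  have hζn : ‖ζ‖ = 1 := hprim.norm'_eq_one hn0
  have ht : ((ε / 2 : ℝ) : ℂ) ∈ ball (0 : ℂ) ε := by
    simp [abs_of_pos hε, hε]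
  have ht' : ζ * ((ε / 2 : ℝ) : ℂ) ∈ ball (0 : ℂ) ε := by
    simp only [mem_ball_zero_iff, norm_mul, hζn, one_mul]
    simpa using ht
  obtain ⟨z, hz, hzt⟩ := hball ht
  obtain ⟨w, hw, hwt⟩ := hball ht'
  have hfe : f z = f w := by
    have h1 := hz.2
    have h2 := hw.2
    rw [hzt] at h1
    rw [hwt, mul_pow, hprim.pow_eq_one, one_mul, ← h1] at h2
    exact (sub_left_injective h2).symm
  have hzw := hinj hz.1 hw.1 hfe
  rw [hzw, hwt] at hzt
  have : ((ε / 2 : ℝ) : ℂ) ≠ 0 := by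
    exact_mod_cast (half_pos hε).ne'
  exact hζ1 (mul_right_cancel₀ this (by rw [hzt, one_mul]))

-- By Schwarz `g z / z` has norm at most `1`, so `g z / z - 1` has real part at most `0` and norm at
-- most `δ` at the origin. Borel–Carathéodory turns this one-sided bound into a bound on the norm.
open Metric Set in
theorem norm_sub_self_le_of_deriv_near_one {g : ℂ → ℂ} {l δ : ℝ}
    (hd : DifferentiableOn ℂ g (ball 0 1)) (hm : MapsTo g (ball 0 1) (ball 0 1)) (h0 : g 0 = 0)
    (hl : deriv g 0 = l) (hδ : 0 < δ) (hlδ : 1 - δ ≤ l) {z : ℂ} (hz : z ∈ ball (0 : ℂ) 1) :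
    ‖g z - z‖ ≤ 4 * δ / (1 - ‖z‖) := by
  have hmc : MapsTo g (ball 0 1) (closedBall (g 0) 1) := by
    rw [h0]; exact fun x hx => ball_subset_closedBall (hm hx)
  have hz1 : ‖z‖ < 1 := by simpa using hz
  have hq1 : ∀ x ∈ ball (0 : ℂ) 1, ‖dslope g 0 x‖ ≤ 1 := fun x hx => by
    simpa using Complex.norm_dslope_le_div_of_mapsTo_ball hd hmc hx
  have hl1 : l ≤ 1 := by
    have := hq1 0 (by simp)
    rw [dslope_same, hl, Complex.norm_real] at this
    exact (le_abs_self l).trans this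
  have hdq : DifferentiableOn ℂ (dslope g 0) (ball 0 1) :=
    (Complex.differentiableOn_dslope (isOpen_ball.mem_nhds (by simp))).2 hd
  have key := Complex.borelCaratheodory (f := fun x => dslope g 0 x - 1) (M := δ) (R := 1) (z := z)
    hδ (hdq.sub_const 1) (fun x hx => by
      have := (Complex.re_le_norm _).trans (hq1 x hx)
      simp only [mem_ofPred_eq, Complex.sub_re, Complex.one_re]
      linarith) one_pos hz
  have hq0 : ‖dslope g 0 0 - 1‖ ≤ δ := by
    rw [dslope_same, hl, ← Complex.ofReal_one, ← Complex.ofReal_sub, Complex.norm_real,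
      Real.norm_eq_abs, abs_le]
    constructor <;> linarith
  have hpos : 0 < 1 - ‖z‖ := by linarith
  have hgz : g z = z * dslope g 0 z := by
    have := sub_smul_dslope g 0 z
    simp only [sub_zero, smul_eq_mul, h0] at this
    exact this.symm
  have h2 : ‖dslope g 0 z - 1‖ ≤ 4 * δ / (1 - ‖z‖) := by
    refine key.trans ?_
    rw [← add_div]
    gcongr
    nlinarith [norm_nonneg z, norm_nonneg (dslope g 0 0 - 1)]
  calc ‖g z - z‖ = ‖z‖ * ‖dslope g 0 z - 1‖ := by rw [← norm_mul, hgz]; ring_nf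
    _ ≤ 1 * ‖dslope g 0 z - 1‖ := by gcongr
    _ ≤ _ := by rwa [one_mul]

-- Cauchy's estimate makes `g - id` Lipschitz with a small constant, so `p ∘ g` inherits the linear
-- approximation of `p`. The order of quantifiers matters: `δ₀` comes first so that several
-- instances can share one `δ`, and `η` follows because the value at the centre may move only by `c
-- * δ`.
open Metric Set Filter Topology in
theorem HasStrictDerivAt.exists_approx_comp_near_id {p : ℂ → ℂ} {p' a : ℂ} {S U : Set ℂ} {c : ℝ}
    (hp : HasStrictDerivAt p p' a) (hS : S ∈ 𝓝 a) (hU : U ∈ 𝓝 a) (hc : 0 < c) :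
    ∃ δ₀ > 0, ∀ δ, 0 < δ → δ ≤ δ₀ → ∃ η > 0, ∀ g : ℂ → ℂ, DifferentiableOn ℂ g S →
      (∀ z ∈ S, ‖g z - z‖ ≤ η) →
        (∀ z ∈ closedBall a δ, z ∈ U ∧ g z ∈ U) ∧
        (∀ z ∈ closedBall a δ, ∀ w ∈ closedBall a δ,
          ‖p (g z) - p (g w) - p' * (z - w)‖ ≤ c * ‖z - w‖) ∧
        ‖p (g a) - p a‖ ≤ c * δ := by
  have hs : ∀ᶠ x in 𝓝 a ×ˢ 𝓝 a, ‖p x.1 - p x.2 - p' * (x.1 - x.2)‖ ≤ c / 4 * ‖x.1 - x.2‖ := by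
    have := (hasStrictFDerivAt_iff_isLittleO.1 hp.hasStrictFDerivAt).def (show 0 < c / 4 by positivity)
    rw [nhds_prod_eq] at this
    filter_upwards [this] with x hx
    simpa [mul_comm] using hx
  obtain ⟨V, hV, hVs⟩ := (eventually_prod_self_iff
    (r := fun x y => ‖p x - p y - p' * (x - y)‖ ≤ c / 4 * ‖x - y‖)).1 hs
  obtain ⟨r, hr, hrs⟩ := Metric.mem_nhds_iff.1 (inter_mem (inter_mem hS hU) hV)
  set ε := r / 4 with hε
  have hε0 : 0 < ε := by positivity
  have hrS : ball a r ⊆ S := fun z hz => (hrs hz).1.1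
  have hrU : ball a r ⊆ U := fun z hz => (hrs hz).1.2
  have hrV : ball a r ⊆ V := fun z hz => (hrs hz).2
  refine ⟨ε, hε0, fun δ hδ hδε => ?_⟩
  -- `κ` will be the Lipschitz constant of `g - id`. With `κ ≤ 1` the map `g` is 2-Lipschitz, and
  -- the total error is at most `c / 2 + ‖p'‖ κ ≤ 3 c / 4`.
  set κ := min 1 (c / (4 * (‖p'‖ + 1))) with hκ
  have hκ0 : 0 < κ := by positivity
  have hκ1 : κ ≤ 1 := min_le_left _ _
  have hκ2 : ‖p'‖ * κ ≤ c / 4 := by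
    have h1 : κ ≤ c / (4 * (‖p'‖ + 1)) := min_le_right _ _
    rw [le_div_iff₀ (by positivity)] at h1
    nlinarith [norm_nonneg p']
  -- The first bound feeds Cauchy's estimate on circles of radius `ε`; the second controls the
  -- displacement of the centre.
  refine ⟨min (κ * ε) (c * δ / (‖p'‖ + c)), by positivity, fun g hg hgη => ?_⟩
  have hg1 : ∀ z ∈ S, ‖g z - z‖ ≤ κ * ε := fun z hz => (hgη z hz).trans (min_le_left _ _)
  have hκε : κ * ε ≤ ε := mul_le_of_le_one_left hε0.le hκ1
  have hball : ∀ z ∈ closedBall a ε, g z ∈ ball a r := by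
    intro z hz
    rw [mem_closedBall] at hz
    have hzS : z ∈ S := hrS (by rw [mem_ball]; linarith)
    rw [mem_ball]
    have h1 := dist_triangle (g z) z a
    have h2 := hg1 z hzS
    rw [← dist_eq_norm] at h2
    linarith
  have hmono : closedBall a δ ⊆ closedBall a ε := closedBall_subset_closedBall hδε
  have hlip : ∀ z ∈ closedBall a ε, ∀ w ∈ closedBall a ε,
      ‖(g z - z) - (g w - w)‖ ≤ κ * ‖z - w‖ := by
    intro z hz w hw
    have hdiff : ∀ x ∈ ball a r, DifferentiableAt ℂ (fun x => g x - x) x := fun x hx =>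
      (hg.differentiableAt (mem_of_superset (isOpen_ball.mem_nhds hx) hrS)).sub
        differentiableAt_id
    refine Convex.norm_image_sub_le_of_norm_deriv_le (f := fun x => g x - x) (s := closedBall a ε)
      (fun x hx => hdiff x ?_) (fun x hx => ?_) (convex_closedBall a ε) hw hz
    · exact closedBall_subset_ball (by linarith) hx
    · have hsub : closedBall x ε ⊆ ball a r := by
        intro y hy
        rw [mem_closedBall] at hx hy
        rw [mem_ball]
        linarith [dist_triangle y x a]
      have := Complex.norm_deriv_le_of_forall_mem_sphere_norm_le (f := fun x => g x - x) (c := x)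
        (R := ε) (C := κ * ε) hε0 (DifferentiableOn.diffContOnCl_ball
          (U := ball a r) (fun y hy => (hdiff y hy).differentiableWithinAt) hsub)
        (fun y hy => hg1 y (hrS (hsub (sphere_subset_closedBall hy))))
      rwa [mul_div_assoc, div_self hε0.ne', mul_one] at this
  refine ⟨fun z hz => ⟨hrU (closedBall_subset_ball (by linarith) (hmono hz)),
    hrU (hball z (hmono hz))⟩, fun z hz w hw => ?_, ?_⟩
  · have h1 := hVs (g z) (hrV (hball z (hmono hz))) (g w) (hrV (hball w (hmono hw)))
    have h2 := hlip z (hmono hz) w (hmono hw)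
    have h3 : ‖g z - g w‖ ≤ (1 + κ) * ‖z - w‖ := by
      have : g z - g w = (z - w) + ((g z - z) - (g w - w)) := by ring
      rw [this]
      refine (norm_add_le _ _).trans ?_
      linarith
    have h4 : p (g z) - p (g w) - p' * (z - w)
        = (p (g z) - p (g w) - p' * (g z - g w)) + p' * ((g z - z) - (g w - w)) := by ring
    rw [h4]
    refine (norm_add_le _ _).trans ?_
    rw [norm_mul]
    have h5 : ‖p'‖ * ‖(g z - z) - (g w - w)‖ ≤ ‖p'‖ * (κ * ‖z - w‖) := by gcongr
    have h6 : c / 4 * ‖g z - g w‖ ≤ c / 4 * (2 * ‖z - w‖) := by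
      gcongr
      refine h3.trans ?_
      gcongr
      linarith
    nlinarith [norm_nonneg (z - w)]
  · have haε : a ∈ closedBall a ε := mem_closedBall_self hε0.le
    have h1 := hVs (g a) (hrV (hball a haε)) a (hrV (mem_ball_self hr))
    have h2 : ‖g a - a‖ ≤ c * δ / (‖p'‖ + c) :=
      (hgη a (mem_of_mem_nhds hS)).trans (min_le_right _ _)
    rw [le_div_iff₀ (by positivity)] at h2
    have h3 : p (g a) - p a = (p (g a) - p a - p' * (g a - a)) + p' * (g a - a) := by ring
    rw [h3]
    refine (norm_add_le _ _).trans ?_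
    rw [norm_mul]
    nlinarith [norm_nonneg (g a - a)]

-- The map `(z, w) ↦ (p z - p w, q z - q w)` vanishes at `(a, b)`, and its derivative `A` there is
-- invertible by `hdet`. Replacing `p`, `q` by `p ∘ g`, `q ∘ k` changes it little in the Lipschitz
-- sense, so the quantitative open mapping theorem still yields a zero nearby.
open Metric Set Filter Topology in
theorem exists_common_coincidence_near_id {p q : ℂ → ℂ} {a b pa pb qa qb : ℂ} {S U V : Set ℂ}
    (hpa : HasStrictDerivAt p pa a) (hpb : HasStrictDerivAt p pb b)
    (hqa : HasStrictDerivAt q qa a) (hqb : HasStrictDerivAt q qb b)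
    (hp : p a = p b) (hq : q a = q b) (hdet : pa * qb - pb * qa ≠ 0)
    (hSa : S ∈ 𝓝 a) (hSb : S ∈ 𝓝 b) (hU : U ∈ 𝓝 a) (hV : V ∈ 𝓝 b) :
    ∃ η > 0, ∀ g k : ℂ → ℂ, DifferentiableOn ℂ g S → DifferentiableOn ℂ k S →
      (∀ z ∈ S, ‖g z - z‖ ≤ η) → (∀ z ∈ S, ‖k z - z‖ ≤ η) →
      ∃ z ∈ U, ∃ w ∈ V, g z ∈ U ∧ k z ∈ U ∧ g w ∈ V ∧ k w ∈ V ∧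
        p (g z) = p (g w) ∧ q (k z) = q (k w) := by
  set A : ℂ × ℂ →L[ℂ] ℂ × ℂ :=
    (pa • ContinuousLinearMap.fst ℂ ℂ ℂ - pb • ContinuousLinearMap.snd ℂ ℂ ℂ).prod
    (qa • ContinuousLinearMap.fst ℂ ℂ ℂ - qb • ContinuousLinearMap.snd ℂ ℂ ℂ) with hA
  have hAx : ∀ x, A x = (pa * x.1 - pb * x.2, qa * x.1 - qb * x.2) := fun x => by simp [hA]
  have hsurj : A.range = ⊤ := by
    rw [LinearMap.range_eq_top]
    rintro ⟨s, t⟩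
    refine ⟨((s * qb - pb * t) / (pa * qb - pb * qa), (qa * s - pa * t) / (pa * qb - pb * qa)), ?_⟩
    change A _ = _
    rw [hAx]
    ext
    · simp only
      rw [← mul_div_assoc, ← mul_div_assoc, ← sub_div, div_eq_iff hdet]
      ring
    · simp only
      rw [← mul_div_assoc, ← mul_div_assoc, ← sub_div, div_eq_iff hdet]
      ring
  set I := A.nonlinearRightInverseOfSurjective hsurj with hI
  have hN : 0 < I.nnnorm := A.nonlinearRightInverseOfSurjective_nnnorm_pos hsurj
  -- The perturbed map approximates `A` up to `2c` and takes `(a, b)` to within `2cδ` of zero. The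
  -- image contains a ball of radius `(N⁻¹ - 2c)δ`, where `N = I.nnnorm`, and `c = N⁻¹ / 4` makes
  -- this exactly `2cδ`.
  set c : NNReal := I.nnnorm⁻¹ / 4 with hc
  have hc0 : 0 < c := by positivity
  have hc0' : (0 : ℝ) < c := by exact_mod_cast hc0
  have hNc : ((I.nnnorm : ℝ))⁻¹ = 4 * c := by
    rw [hc]; push_cast; ring
  obtain ⟨d1, hd1, h1⟩ := hpa.exists_approx_comp_near_id hSa hU hc0'
  obtain ⟨d2, hd2, h2⟩ := hpb.exists_approx_comp_near_id hSb hV hc0'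
  obtain ⟨d3, hd3, h3⟩ := hqa.exists_approx_comp_near_id hSa hU hc0'
  obtain ⟨d4, hd4, h4⟩ := hqb.exists_approx_comp_near_id hSb hV hc0'
  set δ := min (min d1 d2) (min d3 d4) with hδ
  have hδ0 : 0 < δ := by positivity
  obtain ⟨e1, he1, h1⟩ := h1 δ hδ0 ((min_le_left _ _).trans (min_le_left _ _))
  obtain ⟨e2, he2, h2⟩ := h2 δ hδ0 ((min_le_left _ _).trans (min_le_right _ _))
  obtain ⟨e3, he3, h3⟩ := h3 δ hδ0 ((min_le_right _ _).trans (min_le_left _ _))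
  obtain ⟨e4, he4, h4⟩ := h4 δ hδ0 ((min_le_right _ _).trans (min_le_right _ _))
  refine ⟨min (min e1 e2) (min e3 e4), by positivity, fun g k hg hk hgη hkη => ?_⟩
  obtain ⟨h1U, h1L, h1c⟩ := h1 g hg fun z hz =>
    (hgη z hz).trans ((min_le_left _ _).trans (min_le_left _ _))
  obtain ⟨h2U, h2L, h2c⟩ := h2 g hg fun z hz =>
    (hgη z hz).trans ((min_le_left _ _).trans (min_le_right _ _))
  obtain ⟨h3U, h3L, h3c⟩ := h3 k hk fun z hz =>
    (hkη z hz).trans ((min_le_right _ _).trans (min_le_left _ _))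
  obtain ⟨h4U, h4L, h4c⟩ := h4 k hk fun z hz =>
    (hkη z hz).trans ((min_le_right _ _).trans (min_le_right _ _))
  set Φ : ℂ × ℂ → ℂ × ℂ := fun x => (p (g x.1) - p (g x.2), q (k x.1) - q (k x.2)) with hΦ
  have happ : ApproximatesLinearOn Φ A (closedBall (a, b) δ) (2 * c) := by
    rintro ⟨z, w⟩ hx ⟨z', w'⟩ hy
    rw [← closedBall_prod_same, mem_prod] at hx hy
    have n1 : ‖z - z'‖ ≤ ‖((z, w) : ℂ × ℂ) - (z', w')‖ := le_max_left _ _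
    have n2 : ‖w - w'‖ ≤ ‖((z, w) : ℂ × ℂ) - (z', w')‖ := le_max_right _ _
    have e1 := h1L z hx.1 z' hy.1
    have e2 := h2L w hx.2 w' hy.2
    have e3 := h3L z hx.1 z' hy.1
    have e4 := h4L w hx.2 w' hy.2
    have m1 := mul_le_mul_of_nonneg_left n1 hc0'.le
    have m2 := mul_le_mul_of_nonneg_left n2 hc0'.le
    rw [hAx]
    push_cast
    refine max_le ?_ ?_
    · have : p (g z) - p (g w) - (p (g z') - p (g w')) - (pa * (z - z') - pb * (w - w'))
        = (p (g z) - p (g z') - pa * (z - z')) - (p (g w) - p (g w') - pb * (w - w')) := by ring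
      refine (le_of_eq (congrArg norm this)).trans ((norm_sub_le _ _).trans ?_)
      linarith
    · have : q (k z) - q (k w) - (q (k z') - q (k w')) - (qa * (z - z') - qb * (w - w'))
        = (q (k z) - q (k z') - qa * (z - z')) - (q (k w) - q (k w') - qb * (w - w')) := by ring
      refine (le_of_eq (congrArg norm this)).trans ((norm_sub_le _ _).trans ?_)
      linarith
  have hso := happ.surjOn_closedBall_of_nonlinearRightInverse I hδ0.le subset_rfl
  have hmem : (0 : ℂ × ℂ) ∈ closedBall (Φ (a, b)) ((((I.nnnorm : ℝ))⁻¹ - (2 * c : NNReal)) * δ) := by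
    rw [mem_closedBall, dist_zero_left, hNc]
    push_cast
    refine max_le ?_ ?_
    · have : p (g a) - p (g b) = (p (g a) - p a) - (p (g b) - p b) := by rw [hp]; ring
      refine (le_of_eq (congrArg norm this)).trans ((norm_sub_le _ _).trans ?_)
      linarith
    · have : q (k a) - q (k b) = (q (k a) - q a) - (q (k b) - q b) := by rw [hq]; ring
      refine (le_of_eq (congrArg norm this)).trans ((norm_sub_le _ _).trans ?_)
      linarith
  obtain ⟨⟨z, w⟩, hx, hzero⟩ := hso hmem
  rw [← closedBall_prod_same, mem_prod] at hx
  have hz1 := congrArg Prod.fst hzero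
  have hz2 := congrArg Prod.snd hzero
  exact ⟨z, (h1U z hx.1).1, w, (h2U w hx.2).1, (h1U z hx.1).2, (h3U z hx.1).2, (h2U w hx.2).2,
    (h4U w hx.2).2, sub_eq_zero.1 hz1, sub_eq_zero.1 hz2⟩

/-! ### Möbius transformations of the disc -/

noncomputable section

open scoped ComplexConjugate

/-- The automorphism of the unit disc that maps `0` to `c`. -/
def discShift (c z : ℂ) : ℂ := (z + c) / (1 + conj c * z)

/-- The Moebius transformation `z ↦ (α z + β) / (conj β z + conj α)`. -/
def discMoebius (α β z : ℂ) : ℂ := (α * z + β) / (conj β * z + conj α)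

theorem discMoebius_denom_ne_zero {α β z : ℂ} (hα : ‖α‖ = 1) (hβ : ‖β‖ < 1) (hz : ‖z‖ ≤ 1) :
    conj β * z + conj α ≠ 0 := by
  intro h
  have h1 : ‖conj α‖ = ‖conj β * z‖ := by
    rw [eq_neg_of_add_eq_zero_right h, norm_neg]
  rw [norm_mul, RCLike.norm_conj, RCLike.norm_conj, hα] at h1
  nlinarith [norm_nonneg β, norm_nonneg z]

theorem hasDerivAt_discMoebius {α β z : ℂ} (hα : ‖α‖ = 1) (hβ : ‖β‖ < 1) (hz : ‖z‖ ≤ 1) :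
    HasDerivAt (discMoebius α β) ((1 - conj β * β) / (conj β * z + conj α) ^ 2) z := by
  have hα' : conj α * α = 1 := by rw [Complex.conj_mul', hα]; simp
  have h1 : HasDerivAt (fun z => α * z + β) α z := by
    simpa using ((hasDerivAt_id z).const_mul α).add_const β
  have h2 : HasDerivAt (fun z => conj β * z + conj α) (conj β) z := by
    simpa using ((hasDerivAt_id z).const_mul (conj β)).add_const (conj α)
  refine (h1.fun_div h2 (discMoebius_denom_ne_zero hα hβ hz)).congr_deriv ?_
  congr 1
  linear_combination hα'

theorem discShift_eq_discMoebius (c z : ℂ) : discShift c z = discMoebius 1 c z := by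
  simp [discShift, discMoebius, add_comm]

theorem one_add_conj_mul_ne_zero {c z : ℂ} (hc : ‖c‖ < 1) (hz : ‖z‖ ≤ 1) : 1 + conj c * z ≠ 0 := by
  simpa [add_comm] using discMoebius_denom_ne_zero (α := 1) (by simp) hc hz

theorem hasDerivAt_discShift {c z : ℂ} (hc : ‖c‖ < 1) (hz : ‖z‖ ≤ 1) :
    HasDerivAt (discShift c) ((1 - conj c * c) / (1 + conj c * z) ^ 2) z := by
  have := hasDerivAt_discMoebius (α := 1) (by simp) hc hz
  rw [map_one, add_comm] at this
  exact this.congr_of_eventuallyEq (.of_forall (discShift_eq_discMoebius c))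

theorem norm_discShift_lt_one {c z : ℂ} (hc : ‖c‖ < 1) (hz : ‖z‖ < 1) : ‖discShift c z‖ < 1 := by
  rw [discShift, norm_div, div_lt_one (norm_pos_iff.2 (one_add_conj_mul_ne_zero hc hz.le)),
    ← sq_lt_sq₀ (norm_nonneg _) (norm_nonneg _), ← Complex.normSq_eq_norm_sq,
    ← Complex.normSq_eq_norm_sq]
  have h1 : Complex.normSq c < 1 := by
    rw [Complex.normSq_eq_norm_sq]; nlinarith [norm_nonneg c]
  have h2 : Complex.normSq z < 1 := by
    rw [Complex.normSq_eq_norm_sq]; nlinarith [norm_nonneg z]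
  rw [Complex.normSq_apply] at *
  simp only [Complex.normSq_apply, Complex.add_re, Complex.add_im, Complex.mul_re, Complex.mul_im,
    Complex.conj_re, Complex.conj_im, Complex.one_re, Complex.one_im] at *
  nlinarith [mul_pos (sub_pos.2 h1) (sub_pos.2 h2)]

theorem one_sub_conj_mul_self_ne_zero {c : ℂ} (hc : ‖c‖ < 1) : 1 - conj c * c ≠ 0 := by
  rw [Complex.conj_mul', ← Complex.ofReal_pow, ← Complex.ofReal_one, ← Complex.ofReal_sub,
    Complex.ofReal_ne_zero]
  nlinarith [norm_nonneg c]

theorem discShift_discShift_neg {c z : ℂ} (hc : ‖c‖ < 1) (hz : ‖z‖ < 1) :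
    discShift c (discShift (-c) z) = z := by
  have h1 : 1 + -conj c * z ≠ 0 := by
    simpa using one_add_conj_mul_ne_zero (c := -c) (by simpa) hz.le
  have h2 := one_sub_conj_mul_self_ne_zero hc
  simp only [discShift, map_neg]
  have h3 : 1 + conj c * ((z + -c) / (1 + -conj c * z)) = (1 - conj c * c) / (1 + -conj c * z) := by
    rw [eq_div_iff h1, add_mul, mul_assoc, div_mul_cancel₀ _ h1]
    ring
  rw [h3, div_eq_iff (div_ne_zero h2 h1), ← mul_div_assoc, div_add' _ _ _ h1, div_left_inj' h1]
  ring

theorem discShift_neg_discShift {c z : ℂ} (hc : ‖c‖ < 1) (hz : ‖z‖ < 1) :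
    discShift (-c) (discShift c z) = z := by
  simpa using discShift_discShift_neg (c := -c) (by simpa) hz

@[simp] theorem discShift_zero (c : ℂ) : discShift c 0 = c := by simp [discShift]

@[simp] theorem discShift_neg_self (c : ℂ) : discShift (-c) c = 0 := by simp [discShift]

open Metric Set in
theorem differentiableOn_discShift {c : ℂ} (hc : ‖c‖ < 1) :
    DifferentiableOn ℂ (discShift c) (ball 0 1) := fun _ hz =>
  (hasDerivAt_discShift hc (mem_ball_zero_iff.1 hz).le).differentiableAt.differentiableWithinAt

open Metric Set in
theorem mapsTo_discShift {c : ℂ} (hc : ‖c‖ < 1) : MapsTo (discShift c) (ball 0 1) (ball 0 1) :=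
  fun _ hz => by
    rw [mem_ball_zero_iff] at *
    exact norm_discShift_lt_one hc hz

-- After `φ 0` is moved to `0`, Schwarz applied to the map and to its left inverse shows that it
-- preserves norms, hence is a rotation.
open Metric Set in
theorem exists_eqOn_discMoebius {φ ψ : ℂ → ℂ} (hφ : DifferentiableOn ℂ φ (ball 0 1))
    (hψ : DifferentiableOn ℂ ψ (ball 0 1)) (hφm : MapsTo φ (ball 0 1) (ball 0 1))
    (hψm : MapsTo ψ (ball 0 1) (ball 0 1)) (hinv : ∀ z ∈ ball (0 : ℂ) 1, ψ (φ z) = z) :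
    ∃ α β : ℂ, ‖α‖ = 1 ∧ ‖β‖ < 1 ∧ EqOn φ (discMoebius α β) (ball 0 1) := by
  have h0 : (0 : ℂ) ∈ ball (0 : ℂ) 1 := by simp
  set c := φ 0 with hcdef
  have hc : ‖c‖ < 1 := by simpa using hφm h0
  have hc' : ‖-c‖ < 1 := by simpa
  set f : ℂ → ℂ := discShift (-c) ∘ φ with hf
  set k : ℂ → ℂ := ψ ∘ discShift c with hk
  have hfm : MapsTo f (ball 0 1) (ball 0 1) := (mapsTo_discShift hc').comp hφm
  have hkm : MapsTo k (ball 0 1) (ball 0 1) := hψm.comp (mapsTo_discShift hc)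
  have hfd : DifferentiableOn ℂ f (ball 0 1) := (differentiableOn_discShift hc').comp hφ hφm
  have hkd : DifferentiableOn ℂ k (ball 0 1) :=
    hψ.comp (differentiableOn_discShift hc) (mapsTo_discShift hc)
  have hf0 : f 0 = 0 := by simp [hf, ← hcdef]
  have hk0 : k 0 = 0 := by simp [hk, hcdef, hinv 0 h0]
  have hfφ : ∀ z ∈ ball (0 : ℂ) 1, discShift c (f z) = φ z := fun z hz =>
    discShift_discShift_neg hc (by simpa using hφm hz)
  have hkf : ∀ z ∈ ball (0 : ℂ) 1, k (f z) = z := fun z hz => by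
    simp only [hk, Function.comp_apply]
    rw [hfφ z hz, hinv z hz]
  have hnorm : ∀ z ∈ ball (0 : ℂ) 1, ‖f z‖ = ‖z‖ := by
    intro z hz
    refine le_antisymm ?_ ?_
    · exact Complex.norm_le_norm_of_mapsTo_ball hfd (hfm.mono_right ball_subset_closedBall) hf0
        (by simpa using hz)
    · have := Complex.norm_le_norm_of_mapsTo_ball hkd (hkm.mono_right ball_subset_closedBall) hk0
        (z := f z) (by simpa using hfm hz)
      rwa [hkf z hz] at this
  have hhalf : (1 / 2 : ℂ) ∈ ball (0 : ℂ) 1 := by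
    rw [mem_ball_zero_iff]; norm_num
  set u := dslope f 0 (1 / 2) with hu
  have hu1 : ‖u‖ = 1 := by
    rw [hu, dslope_of_ne _ (by norm_num), slope_def_field, hf0, sub_zero, sub_zero, norm_div,
      hnorm _ hhalf, div_self (by norm_num)]
  have haff := Complex.affine_of_mapsTo_ball_of_norm_dslope_eq_div (c := 0) (R₁ := 1) (R₂ := 1) hfd
    (by rw [hf0]; exact hfm.mono_right ball_subset_closedBall) hhalf (by rw [div_one]; exact hu1)
  -- The rotation `z ↦ u z` has the normalized form `w z / conj w` with `w ^ 2 = u`.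
  obtain ⟨w, hw⟩ := IsAlgClosed.exists_pow_nat_eq u two_pos
  have hw1 : ‖w‖ = 1 := by
    have : ‖w‖ ^ 2 = 1 := by rw [← norm_pow, hw, hu1]
    exact (pow_eq_one_iff_of_nonneg (norm_nonneg _) two_ne_zero).1 this
  have hww : w * conj w = 1 := by rw [Complex.mul_conj', hw1]; simp
  have hw0 : w ≠ 0 := left_ne_zero_of_mul_eq_one hww
  refine ⟨w, c * conj w, hw1, by simpa [hw1] using hc, fun z hz => ?_⟩
  have h1 : f z = w ^ 2 * z := by
    have := haff hz
    simp only [hf0, zero_add, sub_zero, smul_eq_mul] at this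
    rw [this, ← hu, hw, mul_comm]
  rw [← hfφ z hz, h1]
  simp only [discShift, discMoebius, map_mul, Complex.conj_conj]
  rw [eq_comm, ← mul_div_mul_left _ _ hw0]
  congr 1
  · linear_combination c * hww
  · linear_combination hww

/-- The trace is `2 * α.re`. A transformation of trace zero is an elliptic involution and has a
fixed point in the disc. -/
theorem re_ne_zero_of_discMoebius_ne {α β : ℂ} (hα : ‖α‖ = 1) (hβ : ‖β‖ < 1)
    (hfix : ∀ z : ℂ, ‖z‖ < 1 → discMoebius α β z ≠ z) : α.re ≠ 0 := by
  intro hre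
  have him : α.im ^ 2 = 1 := by
    have := Complex.sq_norm α
    rw [hα, Complex.normSq_apply, hre] at this
    linarith
  have hα0 : α = α.im * Complex.I := by
    apply Complex.ext <;> simp [hre]
  set m : ℝ := √(1 - ‖β‖ ^ 2) with hm
  have hm2 : m ^ 2 = 1 - ‖β‖ ^ 2 := Real.sq_sqrt (by nlinarith [norm_nonneg β])
  have hm0 : 0 ≤ m := Real.sqrt_nonneg _
  have hm1 : (1 + m : ℂ) ≠ 0 := by
    have : (1 + m : ℝ) ≠ 0 := by positivity
    exact_mod_cast this
  have hbb : conj β * β = 1 - (m : ℂ) ^ 2 := by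
    rw [Complex.conj_mul', ← Complex.ofReal_pow, ← Complex.ofReal_pow, hm2]; push_cast; ring
  have hα2 : α ^ 2 = -1 := by
    rw [hα0, mul_pow, Complex.I_sq, ← Complex.ofReal_pow, him]; simp
  have hcα : conj α = -α := by
    apply Complex.ext <;> simp [hre]
  -- The root inside the disc of the fixed-point equation `conj β * z ^ 2 - 2 * α * z - β = 0`, in a
  -- form that remains valid for `β = 0`.
  have hz : ‖α * β / (1 + m)‖ < 1 := by
    have h1 : ‖(1 + m : ℂ)‖ = 1 + m := by
      rw [← Complex.ofReal_one, ← Complex.ofReal_add, Complex.norm_real, Real.norm_eq_abs,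
        abs_of_nonneg (by positivity)]
    rw [norm_div, norm_mul, hα, h1, one_mul, div_lt_one (by positivity)]
    linarith
  refine hfix _ hz ?_
  rw [discMoebius, div_eq_iff (discMoebius_denom_ne_zero hα hβ hz.le), hcα]
  have hx : conj β * (α * β / (1 + m)) = α * (1 - m) := by
    rw [← mul_div_assoc, div_eq_iff hm1]
    linear_combination α * hbb
  have hy : β = β / (1 + m) * (1 + m) := (div_mul_cancel₀ _ hm1).symm
  rw [hx, mul_div_assoc]
  linear_combination (β / (1 + m)) * (1 + (m : ℂ)) * hα2 + hy

/-- The numerator of `1 - conj a * discMoebius α β a` for `a = t * ζ` with `t` real and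
`‖ζ‖ = 1`. -/
def radialFactor (α β ζ : ℂ) (t : ℝ) : ℂ :=
  conj α - α * t ^ 2 + t * (conj β * ζ - β * conj ζ)

theorem radialFactor_re (α β ζ : ℂ) (t : ℝ) : (radialFactor α β ζ t).re = α.re * (1 - t ^ 2) := by
  have : ((t : ℂ) ^ 2) = ((t ^ 2 : ℝ) : ℂ) := by push_cast; ring
  rw [radialFactor, this]
  simp [-Complex.ofReal_pow]
  ring

/-- On the unit circle the factor vanishes exactly at boundary fixed points. These solve a quadratic
equation, so three trial points suffice. -/
theorem exists_radialFactor_one_ne_zero {α β : ℂ} (h : β ≠ 0 ∨ α.im ≠ 0) :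
    ∃ ζ : ℂ, ‖ζ‖ = 1 ∧ (radialFactor α β ζ 1).im ≠ 0 := by
  by_contra! hcon
  have h1 := hcon 1 (by simp)
  have h2 := hcon (-1) (by simp)
  have h3 := hcon Complex.I (by simp)
  simp [radialFactor] at h1 h2 h3
  have hα : α.im = 0 := by linarith
  have hβ : β.im = 0 := by linarith
  have hβ' : β.re = 0 := by linarith
  rcases h with h | h
  · exact h (Complex.ext hβ' hβ)
  · exact h hα

-- Let `a = t ζ` run towards a boundary point `ζ` that is not fixed. With `N = radialFactor α β ζ`
-- and `B = 1 - ‖β‖²`, the pseudohyperbolic distance `r` from `a` to its image satisfies `1 - r² = B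
-- (1 - t²)² / ‖N t‖²`, which tends to `0`; the intermediate value theorem yields every `r` near
-- `1`. The multiplier is `B (1 - t²)² / (N t)²`, so equality of the squares would force `N t` to be
-- real or purely imaginary. The first is excluded by the choice of `ζ`, the second by `α.re ≠ 0`.
open Set Filter Topology in
theorem exists_discMoebius_pair {α β : ℂ} (hα : ‖α‖ = 1) (hβ : ‖β‖ < 1)
    (hfix : ∀ z : ℂ, ‖z‖ < 1 → discMoebius α β z ≠ z) :
    ∃ r₀ : ℝ, 0 < r₀ ∧ r₀ < 1 ∧ ∀ r, r₀ ≤ r → r < 1 → ∃ a : ℂ, ‖a‖ < 1 ∧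
      ‖discShift (-a) (discMoebius α β a)‖ = r ∧
      ((1 - conj β * β) / (conj β * a + conj α) ^ 2 *
        (1 + conj a * discShift (-a) (discMoebius α β a)) ^ 2) ^ 2 ≠ ((1 : ℂ) - r ^ 2) ^ 2 := by
  have hre := re_ne_zero_of_discMoebius_ne hα hβ hfix
  have hne : β ≠ 0 ∨ α.im ≠ 0 := by
    by_contra! hcon
    refine hfix 0 (by simp) ?_
    simp [discMoebius, hcon.1]
  obtain ⟨ζ, hζ, hζim⟩ := exists_radialFactor_one_ne_zero hne
  have hαα : conj α * α = 1 := by rw [Complex.conj_mul', hα]; simp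
  set N : ℝ → ℂ := radialFactor α β ζ with hN
  have hNc : Continuous N := by
    rw [hN]
    unfold radialFactor
    fun_prop
  have hev : ∀ᶠ t in 𝓝 (1 : ℝ), (N t).im ≠ 0 :=
    (Complex.continuous_im.comp hNc).continuousAt.eventually_ne hζim
  obtain ⟨ε, hε, hball⟩ := Metric.eventually_nhds_iff.1 hev
  set t₀ : ℝ := max (1 / 2) (1 - ε / 2) with ht₀
  have ht₀0 : 0 < t₀ := lt_of_lt_of_le (by norm_num) (le_max_left _ _)
  have ht₀1 : t₀ < 1 := max_lt (by norm_num) (by linarith)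
  have him : ∀ t ∈ Icc t₀ 1, (N t).im ≠ 0 := by
    intro t ht
    apply hball
    have := (le_max_right _ _).trans ht.1
    rw [Real.dist_eq, abs_lt]
    constructor <;> linarith [ht.2]
  have hN0 : ∀ t ∈ Icc t₀ 1, N t ≠ 0 := fun t ht h0 => him t ht (by rw [h0]; simp)
  set B : ℝ := 1 - ‖β‖ ^ 2 with hB
  have hB0 : 0 < B := by rw [hB]; nlinarith [norm_nonneg β]
  set s : ℝ → ℝ := fun t => B * (1 - t ^ 2) ^ 2 / ‖N t‖ ^ 2 with hs
  have hsc : ContinuousOn s (Icc t₀ 1) := by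
    refine ContinuousOn.div (by fun_prop) (by fun_prop) fun t ht => ?_
    have := norm_pos_iff.2 (hN0 t ht)
    positivity
  have hs1 : s 1 = 0 := by simp [hs]
  have hst₀ : 0 < s t₀ := by
    have := norm_pos_iff.2 (hN0 t₀ ⟨le_rfl, ht₀1.le⟩)
    have h2 : 0 < 1 - t₀ ^ 2 := by nlinarith
    positivity
  -- For `r ≥ 1 - s t₀ / 2` one has `1 - r² ≤ 2 (1 - r) ≤ s t₀`, so `1 - r²` lies in the range of
  -- `s`.
  set r₀ : ℝ := max (1 / 2) (1 - s t₀ / 2) with hr₀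
  refine ⟨r₀, lt_of_lt_of_le (by norm_num) (le_max_left _ _), max_lt (by norm_num) (by linarith),
    fun r hr hr1 => ?_⟩
  have hr2 : 1 / 2 ≤ r := (le_max_left _ _).trans hr
  have hr3 : 1 - s t₀ / 2 ≤ r := (le_max_right _ _).trans hr
  have hmem : 1 - r ^ 2 ∈ Icc (s 1) (s t₀) := by
    rw [hs1]
    constructor <;> nlinarith
  obtain ⟨t, ht, hst⟩ := intermediate_value_Icc' ht₀1.le hsc hmem
  have ht1 : t < 1 := by
    refine lt_of_le_of_ne ht.2 ?_
    rintro rfl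
    rw [hs1] at hst
    nlinarith
  have ht0 : 0 < t := ht₀0.trans_le ht.1
  have htt : 0 < 1 - t ^ 2 := by nlinarith
  set a : ℂ := t * ζ with ha
  have ha1 : ‖a‖ = t := by
    rw [ha, norm_mul, hζ, mul_one, Complex.norm_real, Real.norm_eq_abs, abs_of_pos ht0]
  have hca : conj a = t * conj ζ := by simp [ha]
  have haa : conj a * a = (t : ℂ) ^ 2 := by rw [Complex.conj_mul', ha1]
  have hD := discMoebius_denom_ne_zero hα hβ (z := a) (by rw [ha1]; exact ht.2)
  set D := conj β * a + conj α with hDdef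
  have hNt := hN0 t ht
  have h1 : 1 + -conj a * discMoebius α β a = N t / D := by
    rw [discMoebius, ← hDdef, eq_div_iff hD, add_mul, mul_assoc, div_mul_cancel₀ _ hD, hDdef]
    simp only [hN, radialFactor]
    linear_combination (-α) * haa + conj β * ha - β * hca
  have h2 : discShift (-a) (discMoebius α β a) = (discMoebius α β a - a) * D / N t := by
    rw [discShift, map_neg, h1]
    field_simp
    ring
  have h3 : 1 + conj a * discShift (-a) (discMoebius α β a) = (1 - (t : ℂ) ^ 2) * D / N t := by
    have h4 : 1 + conj a * discShift (-a) (discMoebius α β a)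
        = ((1 + -conj a * discMoebius α β a) * D + conj a * (discMoebius α β a - a) * D
          - (N t / D) * D + N t) / N t := by
      rw [h2, h1]
      field_simp
      ring
    rw [h4, div_mul_cancel₀ _ hD]
    congr 1
    linear_combination (-D) * haa
  have hq : (1 - conj β * β) / D ^ 2 *
        (1 + conj a * discShift (-a) (discMoebius α β a)) ^ 2 = (B : ℂ) * (1 - (t : ℂ) ^ 2) ^ 2 / N t ^ 2 := by
    rw [h3, Complex.conj_mul', hB]
    push_cast
    field_simp
  have hrs : ‖discShift (-a) (discMoebius α β a)‖ ^ 2 = r ^ 2 := by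
    have h5 : (discMoebius α β a - a) * D = α * a + β - a * (conj β * a + conj α) := by
      rw [sub_mul, discMoebius, ← hDdef, div_mul_cancel₀ _ hD]
    have h6 : ((‖(discMoebius α β a - a) * D‖ : ℂ)) ^ 2
        = (‖N t‖ : ℂ) ^ 2 - (B : ℂ) * (1 - (t : ℂ) ^ 2) ^ 2 := by
      have h7 : N t = conj α - α * (conj a * a) + (conj β * a - β * conj a) := by
        simp only [hN, radialFactor]
        rw [haa, hca, ha]
        ring
      have h8 : (B : ℂ) = conj α * α - conj β * β := by
        rw [hαα, Complex.conj_mul', hB]; push_cast; ring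
      rw [← Complex.mul_conj', ← Complex.mul_conj', h5, h7, h8, ← haa]
      simp only [map_sub, map_add, map_mul, Complex.conj_conj]
      ring
    have h7 : ‖(discMoebius α β a - a) * D‖ ^ 2 = ‖N t‖ ^ 2 - B * (1 - t ^ 2) ^ 2 := by
      exact_mod_cast h6
    have h8 : ‖N t‖ ^ 2 ≠ 0 := pow_ne_zero 2 (norm_ne_zero_iff.2 hNt)
    have h9 : r ^ 2 = 1 - s t := by rw [hst]; ring
    rw [h2, norm_div, div_pow, h7, h9, sub_div, div_self h8]
  refine ⟨a, by rw [ha1]; exact ht1, (pow_left_inj₀ (norm_nonneg _) (by linarith) two_ne_zero).1 hrs,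
    ?_⟩
  rw [hq]
  intro hcon
  have hr : ((1 : ℂ) - r ^ 2) = (B : ℂ) * (1 - (t : ℂ) ^ 2) ^ 2 / (N t * conj (N t)) := by
    rw [Complex.mul_conj']
    exact_mod_cast hst.symm
  have hK : (B : ℂ) * (1 - (t : ℂ) ^ 2) ^ 2 ≠ 0 := by
    have : B * (1 - t ^ 2) ^ 2 ≠ 0 := by positivity
    exact_mod_cast this
  rw [hr, div_pow, div_pow, div_eq_div_iff (by simpa using hNt) (by simpa using hNt)] at hcon
  replace hcon := mul_left_cancel₀ (pow_ne_zero 2 hK) hcon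
  have hsq : (N t) ^ 2 = (conj (N t)) ^ 2 := by
    have : (N t) ^ 2 * ((N t) ^ 2 - (conj (N t)) ^ 2) = 0 := by linear_combination -hcon
    exact sub_eq_zero.1 ((mul_eq_zero.1 this).resolve_left (pow_ne_zero 2 hNt))
  rcases sq_eq_sq_iff_eq_or_eq_neg.1 hsq with h | h
  · have := congrArg Complex.im h
    simp only [Complex.conj_im] at this
    exact him t ht (by linarith)
  · have := congrArg Complex.re h
    simp only [Complex.neg_re, Complex.conj_re, hN, radialFactor_re] at this
    exact mul_ne_zero hre htt.ne' (by linarith)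

end

/-! ### Holomorphic discs in a Riemann surface -/

noncomputable section

open Metric Set Filter Topology

section DiscMaps

variable {Y : Type*} [TopologicalSpace Y] [ChartedSpace ℂ Y]

/-- The derivative of a map from `ℂ` to a Riemann surface, in the preferred chart at the image
point. -/
def discDeriv (P : ℂ → Y) (z : ℂ) : ℂ := mfderiv 𝓘(ℂ, ℂ) 𝓘(ℂ, ℂ) P z (1 : ℂ)

theorem MDifferentiableOn.mdifferentiableAt_of_mem_ball {P : ℂ → Y}
    (hP : MDifferentiableOn 𝓘(ℂ, ℂ) 𝓘(ℂ, ℂ) P (ball 0 1)) {z : ℂ} (hz : z ∈ ball (0 : ℂ) 1) :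
    MDifferentiableAt 𝓘(ℂ, ℂ) 𝓘(ℂ, ℂ) P z :=
  hP.mdifferentiableAt (isOpen_ball.mem_nhds hz)

theorem hasDerivAt_chartAt_comp {P : ℂ → Y} {z : ℂ}
    (hP : MDifferentiableAt 𝓘(ℂ, ℂ) 𝓘(ℂ, ℂ) P z) :
    HasDerivAt (chartAt ℂ (P z) ∘ P) (discDeriv P z) z := by
  have h := hP.hasMFDerivAt.2
  rw [ModelWithCorners.Boundaryless.range_eq_univ] at h
  set L : ℂ →L[ℂ] ℂ := mfderiv 𝓘(ℂ, ℂ) 𝓘(ℂ, ℂ) P z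
  have h1 : HasFDerivWithinAt (chartAt ℂ (P z) ∘ P) L univ z := h
  exact (hasFDerivWithinAt_univ.1 h1).hasDerivAt

theorem discDeriv_comp {P : ℂ → Y} {h : ℂ → ℂ} {z h' : ℂ}
    (hP : MDifferentiableAt 𝓘(ℂ, ℂ) 𝓘(ℂ, ℂ) P (h z)) (hh : HasDerivAt h h' z) :
    discDeriv (P ∘ h) z = h' * discDeriv P (h z) := by
  have e := mfderiv_comp z hP hh.differentiableAt.mdifferentiableAt
  rw [discDeriv, e, mfderiv_eq_fderiv, discDeriv]
  have h1 : (fderiv ℂ h z) 1 = h' • (1 : ℂ) := by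
    rw [hh.hasFDerivAt.fderiv]; simp
  change (mfderiv 𝓘(ℂ, ℂ) 𝓘(ℂ, ℂ) P (h z)) ((fderiv ℂ h z) 1) = _
  rw [h1]
  exact (mfderiv 𝓘(ℂ, ℂ) 𝓘(ℂ, ℂ) P (h z)).map_smul h' (1 : ℂ)

/-- A holomorphic immersion of the unit disc through which all holomorphic discs lift. -/
structure IsDiscCover (P : ℂ → Y) : Prop where
  mdifferentiableOn : MDifferentiableOn 𝓘(ℂ, ℂ) 𝓘(ℂ, ℂ) P (ball 0 1)
  discDeriv_ne_zero : ∀ z ∈ ball (0 : ℂ) 1, discDeriv P z ≠ 0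
  exists_lift : ∀ f : ℂ → Y, MDifferentiableOn 𝓘(ℂ, ℂ) 𝓘(ℂ, ℂ) f (ball 0 1) →
    ∀ z₀ ∈ ball (0 : ℂ) 1, ∀ x₀ ∈ ball (0 : ℂ) 1, P x₀ = f z₀ →
      ∃ g : ℂ → ℂ, DifferentiableOn ℂ g (ball 0 1) ∧ MapsTo g (ball 0 1) (ball 0 1) ∧
        g z₀ = x₀ ∧ ∀ z ∈ ball (0 : ℂ) 1, P (g z) = f z

theorem IsDiscCover.comp {P : ℂ → Y} (hP : IsDiscCover P) {h k : ℂ → ℂ}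
    (hh : DifferentiableOn ℂ h (ball 0 1)) (hk : DifferentiableOn ℂ k (ball 0 1))
    (hhm : MapsTo h (ball 0 1) (ball 0 1)) (hkm : MapsTo k (ball 0 1) (ball 0 1))
    (hkh : ∀ z ∈ ball (0 : ℂ) 1, k (h z) = z) (hhk : ∀ z ∈ ball (0 : ℂ) 1, h (k z) = z) :
    IsDiscCover (P ∘ h) where
  mdifferentiableOn := hP.mdifferentiableOn.comp hh.mdifferentiableOn hhm
  discDeriv_ne_zero z hz := by
    have hn := isOpen_ball.mem_nhds hz
    have h1 := (hh.differentiableAt hn).hasDerivAt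
    have h2 := (hk.differentiableAt (isOpen_ball.mem_nhds (hhm hz))).hasDerivAt
    rw [discDeriv_comp (hP.mdifferentiableOn.mdifferentiableAt_of_mem_ball (hhm hz)) h1]
    refine mul_ne_zero (fun h0 => ?_) (hP.discDeriv_ne_zero _ (hhm hz))
    have h3 : HasDerivAt (fun z => k (h z)) (deriv k (h z) * deriv h z) z := h2.comp z h1
    have h4 : HasDerivAt (fun z => k (h z)) 1 z := (hasDerivAt_id z).congr_of_eventuallyEq <| by
      filter_upwards [hn] with w hw using hkh w hw
    have := h3.unique h4
    rw [h0, mul_zero] at this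
    exact zero_ne_one this
  exists_lift f hf z₀ hz₀ x₀ hx₀ he := by
    obtain ⟨g, hg, hgm, hg0, hgf⟩ := hP.exists_lift f hf z₀ hz₀ (h x₀) (hhm hx₀) he
    refine ⟨k ∘ g, hk.comp hg hgm, hkm.comp hgm, ?_, fun z hz => ?_⟩
    · rw [Function.comp_apply, hg0, hkh x₀ hx₀]
    · simp only [Function.comp_apply]
      rw [hhk _ (hgm hz), hgf z hz]

variable [IsManifold 𝓘(ℂ, ℂ) ω Y]

theorem analyticAt_chartAt_comp {P : ℂ → Y} {y : Y} {z : ℂ}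
    (hP : MDifferentiableOn 𝓘(ℂ, ℂ) 𝓘(ℂ, ℂ) P (ball 0 1)) (hz : z ∈ ball (0 : ℂ) 1)
    (hy : P z ∈ (chartAt ℂ y).source) : AnalyticAt ℂ (chartAt ℂ y ∘ P) z := by
  have : IsManifold 𝓘(ℂ, ℂ) 1 Y := IsManifold.of_le (n := ω) le_top
  rw [Complex.analyticAt_iff_eventually_differentiableAt]
  have h1 : ∀ᶠ w in 𝓝 z, P w ∈ (chartAt ℂ y).source :=
    (hP.mdifferentiableAt_of_mem_ball hz).continuousAt ((chartAt ℂ y).open_source.mem_nhds hy)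
  filter_upwards [h1, isOpen_ball.mem_nhds hz] with w hw hwb
  have h2 : MDifferentiableAt 𝓘(ℂ, ℂ) 𝓘(ℂ, ℂ) (chartAt ℂ y) (P w) :=
    mdifferentiableAt_atlas (chart_mem_atlas ℂ y) hw
  exact (h2.comp w (hP.mdifferentiableAt_of_mem_ball hwb)).differentiableAt

theorem hasStrictDerivAt_chartAt_comp {P : ℂ → Y} {y : Y} {z : ℂ}
    (hP : MDifferentiableOn 𝓘(ℂ, ℂ) 𝓘(ℂ, ℂ) P (ball 0 1)) (hz : z ∈ ball (0 : ℂ) 1)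
    (hy : P z = y) : HasStrictDerivAt (chartAt ℂ y ∘ P) (discDeriv P z) z := by
  subst hy
  have := (analyticAt_chartAt_comp hP hz (mem_chart_source ℂ (P z))).hasStrictDerivAt
  rwa [(hasDerivAt_chartAt_comp (hP.mdifferentiableAt_of_mem_ball hz)).deriv] at this

theorem discDeriv_ne_zero_of_injOn {P : ℂ → Y} {z : ℂ} {U : Set ℂ}
    (hP : MDifferentiableOn 𝓘(ℂ, ℂ) 𝓘(ℂ, ℂ) P (ball 0 1)) (hz : z ∈ ball (0 : ℂ) 1)
    (hU : U ∈ 𝓝 z) (hinj : InjOn P U) : discDeriv P z ≠ 0 := by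
  have ha := analyticAt_chartAt_comp hP hz (mem_chart_source ℂ (P z))
  rw [← (hasDerivAt_chartAt_comp (hP.mdifferentiableAt_of_mem_ball hz)).deriv]
  have h1 : P ⁻¹' (chartAt ℂ (P z)).source ∈ 𝓝 z :=
    (hP.mdifferentiableAt_of_mem_ball hz).continuousAt
      ((chartAt ℂ (P z)).open_source.mem_nhds (mem_chart_source ℂ (P z)))
  exact ha.deriv_ne_zero_of_injOn (inter_mem hU h1) fun x hx y hy hxy =>
    hinj hx.1 hy.1 ((chartAt ℂ (P z)).injOn hx.2 hy.2 hxy)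

/-- Near `z` the continuous lift is `f`, read in a chart, followed by the holomorphic local inverse
of `P`. -/
theorem differentiableAt_of_comp_eventuallyEq {P f : ℂ → Y} {g : ℂ → ℂ} {z : ℂ}
    (hP : MDifferentiableOn 𝓘(ℂ, ℂ) 𝓘(ℂ, ℂ) P (ball 0 1))
    (hf : MDifferentiableOn 𝓘(ℂ, ℂ) 𝓘(ℂ, ℂ) f (ball 0 1)) (hz : z ∈ ball (0 : ℂ) 1)
    (hgz : g z ∈ ball (0 : ℂ) 1) (hd : discDeriv P (g z) ≠ 0) (hg : ContinuousAt g z)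
    (he : ∀ᶠ w in 𝓝 z, P (g w) = f w) : DifferentiableAt ℂ g z := by
  have hs := hasStrictDerivAt_chartAt_comp hP hgz rfl
  have h1 := hg.eventually (hs.eventually_left_inverse hd)
  have h2 := (hs.to_localInverse hd).hasDerivAt.differentiableAt
  have hfz : f z = P (g z) := he.self_of_nhds.symm
  have h3 : DifferentiableAt ℂ (chartAt ℂ (P (g z)) ∘ f) z :=
    (analyticAt_chartAt_comp hf hz (by rw [hfz]; exact mem_chart_source ℂ _)).differentiableAt
  have h4 : (chartAt ℂ (P (g z)) ∘ f) z = (chartAt ℂ (P (g z)) ∘ P) (g z) := by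
    simp only [Function.comp_apply, hfz]
  rw [← h4] at h2
  refine (h2.comp z h3).congr_of_eventuallyEq ?_
  filter_upwards [h1, he] with w hw hw'
  rw [← hw]
  simp only [Function.comp_apply, hw']

end DiscMaps

/-! ### Universal coverings and deck transformations -/

theorem IsCoveringMap.eqOn_ball_of_comp_eq {Y : Type*} [TopologicalSpace Y] {π : ℂ → Y}
    (hcov : IsCoveringMap ((ball (0 : ℂ) 1).domRestrict π)) {g₁ g₂ : ℂ → ℂ}
    (h₁ : ContinuousOn g₁ (ball 0 1)) (h₂ : ContinuousOn g₂ (ball 0 1))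
    (hm₁ : MapsTo g₁ (ball 0 1) (ball 0 1)) (hm₂ : MapsTo g₂ (ball 0 1) (ball 0 1))
    (he : ∀ z ∈ ball (0 : ℂ) 1, π (g₁ z) = π (g₂ z)) {a : ℂ} (ha : a ∈ ball (0 : ℂ) 1)
    (hag : g₁ a = g₂ a) : EqOn g₁ g₂ (ball 0 1) := by
  have : PreconnectedSpace (ball (0 : ℂ) 1) :=
    isPreconnected_iff_preconnectedSpace.1 (convex_ball (0 : ℂ) 1).isPreconnected
  have := hcov.eq_of_comp_eq (h₁.mapsToRestrict hm₁) (h₂.mapsToRestrict hm₂)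
    (funext fun z => he z z.2) ⟨a, ha⟩ (Subtype.ext hag)
  intro z hz
  exact congrArg Subtype.val (congrFun this ⟨z, hz⟩)

/-- An injective covering would be a homeomorphism from the open disc onto a compact space. This is
where compactness of the surface enters. -/
theorem IsCoveringMap.not_injOn_ball {Y : Type*} [TopologicalSpace Y] [CompactSpace Y] {π : ℂ → Y}
    (hcov : IsCoveringMap ((ball (0 : ℂ) 1).domRestrict π))
    (hsurj : SurjOn π (ball 0 1) univ) : ¬ InjOn π (ball 0 1) := by
  intro hinj
  have hb : Function.Bijective ((ball (0 : ℂ) 1).domRestrict π) := by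
    refine ⟨injOn_iff_injective.1 hinj, fun y => ?_⟩
    obtain ⟨x, hx, rfl⟩ := hsurj (mem_univ y)
    exact ⟨⟨x, hx⟩, rfl⟩
  have : CompactSpace (ball (0 : ℂ) 1) :=
    (hcov.isLocalHomeomorph.toHomeomorphOfBijective hb).symm.compactSpace
  have hcl : IsClosed (ball (0 : ℂ) 1) := (isCompact_iff_compactSpace.2 ‹_›).isClosed
  have h1 : (1 : ℂ) ∈ closure (ball (0 : ℂ) 1) := by
    rw [closure_ball _ one_ne_zero]; simp
  rw [hcl.closure_eq] at h1
  simp at h1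

section Covering

variable {Y : Type*} [TopologicalSpace Y] [ChartedSpace ℂ Y] [IsManifold 𝓘(ℂ, ℂ) ω Y]

/-- Coverings are locally injective, hence immersions. The disc is simply connected, so continuous
lifts exist, and they are holomorphic because the covering is locally biholomorphic. -/
theorem IsCoveringMap.isDiscCover {π : ℂ → Y}
    (hπ : MDifferentiableOn 𝓘(ℂ, ℂ) 𝓘(ℂ, ℂ) π (ball 0 1))
    (hcov : IsCoveringMap ((ball (0 : ℂ) 1).domRestrict π)) : IsDiscCover π := by
  have hd : ∀ z ∈ ball (0 : ℂ) 1, discDeriv π z ≠ 0 := by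
    intro z hz
    obtain ⟨U, hUo, hzU, hinj⟩ := hcov.isLocalHomeomorph.isLocallyInjective ⟨z, hz⟩
    refine discDeriv_ne_zero_of_injOn hπ hz (U := Subtype.val '' U) ?_ ?_
    · exact (isOpen_ball.isOpenMap_subtype_val U hUo).mem_nhds ⟨_, hzU, rfl⟩
    · rintro _ ⟨x, hx, rfl⟩ _ ⟨y, hy, rfl⟩ hxy
      exact congrArg Subtype.val (hinj hx hy hxy)
  refine ⟨hπ, hd, fun f hf z₀ hz₀ x₀ hx₀ he => ?_⟩
  have : ContractibleSpace (ball (0 : ℂ) 1) := contractibleSpace_ball one_pos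
  have : LocallyPathConnectedSpace (ball (0 : ℂ) 1) := isOpen_ball.locallyPathConnectedSpace
  have hfc : Continuous ((ball (0 : ℂ) 1).domRestrict f) :=
    continuousOn_iff_continuous_domRestrict.1 hf.continuousOn
  obtain ⟨F, ⟨hF0, hFf⟩, -⟩ := hcov.existsUnique_continuousMap_lifts ⟨_, hfc⟩ ⟨z₀, hz₀⟩
    ⟨x₀, hx₀⟩ he
  classical
  set g : ℂ → ℂ := fun z => if hz : z ∈ ball (0 : ℂ) 1 then F ⟨z, hz⟩ else 0 with hg
  have hgF : ∀ z (hz : z ∈ ball (0 : ℂ) 1), g z = F ⟨z, hz⟩ := fun z hz => by simp only [hg, dif_pos hz]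
  have hgm : MapsTo g (ball 0 1) (ball 0 1) := fun z hz => by
    rw [hgF z hz]; exact (F ⟨z, hz⟩).2
  have hgf : ∀ z ∈ ball (0 : ℂ) 1, π (g z) = f z := fun z hz => by
    rw [hgF z hz]; exact congrFun hFf ⟨z, hz⟩
  have hgc : ContinuousOn g (ball 0 1) := by
    rw [continuousOn_iff_continuous_domRestrict]
    refine (continuous_subtype_val.comp F.continuous).congr fun z => ?_
    exact (hgF z z.2).symm
  refine ⟨g, fun z hz => ?_, hgm, ?_, hgf⟩
  · have hn := isOpen_ball.mem_nhds hz
    refine (differentiableAt_of_comp_eventuallyEq hπ hf hz (hgm hz) (hd _ (hgm hz))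
      (hgc.continuousAt hn) ?_).differentiableWithinAt
    filter_upwards [hn] with w hw using hgf w hw
  · rw [hgF z₀ hz₀, hF0]

/-- Two points `a ≠ b` in one fibre give lifts `φ`, `ψ` of `π` through itself with `φ a = b` and `ψ
b = a`. By uniqueness of lifts `ψ ∘ φ` is the identity, and a fixed point of `φ` would make `φ` the
identity. -/
theorem IsHyperbolicRiemannSurface.exists_deck [CompactSpace Y]
    (hY : IsHyperbolicRiemannSurface Y) :
    ∃ (π : ℂ → Y) (α β : ℂ), IsDiscCover π ∧ ‖α‖ = 1 ∧ ‖β‖ < 1 ∧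
      (∀ z : ℂ, ‖z‖ < 1 → discMoebius α β z ≠ z) ∧
      ∀ z : ℂ, ‖z‖ < 1 → ‖discMoebius α β z‖ < 1 ∧ π (discMoebius α β z) = π z := by
  obtain ⟨π, hπ, hsurj, hcov⟩ := hY
  have hdc := IsCoveringMap.isDiscCover hπ hcov
  have hni := hcov.not_injOn_ball hsurj
  simp only [InjOn, not_forall] at hni
  obtain ⟨a, ha, b, hb, hab, hne⟩ := hni
  obtain ⟨φ, hφ, hφm, hφa, hφπ⟩ := hdc.exists_lift π hπ a ha b hb hab.symm
  obtain ⟨ψ, hψ, hψm, hψb, hψπ⟩ := hdc.exists_lift π hπ b hb a ha hab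
  have hinv : EqOn (ψ ∘ φ) id (ball 0 1) := hcov.eqOn_ball_of_comp_eq
    (hψ.comp hφ hφm).continuousOn continuousOn_id (hψm.comp hφm) (mapsTo_id _)
    (fun z hz => by
      rw [Function.comp_apply, hψπ _ (hφm hz), hφπ z hz, id]) ha (by simp [hφa, hψb])
  obtain ⟨α, β, hα, hβ, heq⟩ := exists_eqOn_discMoebius hφ hψ hφm hψm hinv
  refine ⟨π, α, β, hdc, hα, hβ, fun z hz h => ?_, fun z hz => ?_⟩
  · have hz' : z ∈ ball (0 : ℂ) 1 := mem_ball_zero_iff.2 hz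
    have := hcov.eqOn_ball_of_comp_eq hφ.continuousOn continuousOn_id hφm (mapsTo_id _) hφπ hz'
      (by rw [heq hz', h, id])
    exact hne (by rw [← hφa, this ha, id])
  · have hz' : z ∈ ball (0 : ℂ) 1 := mem_ball_zero_iff.2 hz
    rw [← heq hz', ← mem_ball_zero_iff]
    exact ⟨hφm hz', hφπ z hz'⟩

end Covering

end

noncomputable section

open Metric Set Filter Topology
open scoped ComplexConjugate

/-! ### Coverings that identify `0` and `r` -/

section Pairs

variable {Y : Type*} [TopologicalSpace Y] [ChartedSpace ℂ Y]

theorem discDeriv_congr {P Q : ℂ → Y} {z : ℂ} (hP : MDifferentiableAt 𝓘(ℂ, ℂ) 𝓘(ℂ, ℂ) P z)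
    (h : P =ᶠ[𝓝 z] Q) : discDeriv P z = discDeriv Q z := by
  have hQ : MDifferentiableAt 𝓘(ℂ, ℂ) 𝓘(ℂ, ℂ) Q z := hP.congr_of_eventuallyEq h.symm
  have h1 := hasDerivAt_chartAt_comp hP
  have h2 := hasDerivAt_chartAt_comp hQ
  rw [← h.eq_of_nhds] at h2
  refine h1.unique (h2.congr_of_eventuallyEq ?_)
  filter_upwards [h] with w hw
  simp only [Function.comp_apply, hw]

theorem IsDiscCover.comp_discShift {P : ℂ → Y} (hP : IsDiscCover P) {a : ℂ} (ha : ‖a‖ < 1) :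
    IsDiscCover (P ∘ discShift a) := by
  have ha' : ‖-a‖ < 1 := by simpa
  exact hP.comp (differentiableOn_discShift ha) (differentiableOn_discShift ha')
    (mapsTo_discShift ha) (mapsTo_discShift ha')
    (fun z hz => discShift_neg_discShift ha (mem_ball_zero_iff.1 hz))
    (fun z hz => discShift_discShift_neg ha (mem_ball_zero_iff.1 hz))

theorem IsDiscCover.comp_rotation {P : ℂ → Y} (hP : IsDiscCover P) {u : ℂ} (hu : ‖u‖ = 1) :
    IsDiscCover (P ∘ fun z => u * z) := by
  have hu0 : u ≠ 0 := by
    rintro rfl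
    simp at hu
  refine hP.comp (k := fun z => u⁻¹ * z) (by fun_prop) (by fun_prop) (fun z hz => ?_)
    (fun z hz => ?_) (fun z _ => ?_) (fun z _ => ?_)
  · simpa [hu] using hz
  · simpa [hu] using hz
  · simp [hu0]
  · simp [hu0]

theorem discDeriv_comp_discShift {P : ℂ → Y} (hP : IsDiscCover P) {a z : ℂ} (ha : ‖a‖ < 1)
    (hz : ‖z‖ < 1) : discDeriv (P ∘ discShift a) z =
      (1 - conj a * a) / (1 + conj a * z) ^ 2 * discDeriv P (discShift a z) :=
  discDeriv_comp (hP.mdifferentiableOn.mdifferentiableAt_of_mem_ball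
    (mem_ball_zero_iff.2 (norm_discShift_lt_one ha hz))) (hasDerivAt_discShift ha hz.le)

theorem discDeriv_comp_rotation {P : ℂ → Y} (hP : IsDiscCover P) {u z : ℂ} (hu : ‖u‖ = 1)
    (hz : ‖z‖ < 1) : discDeriv (P ∘ fun z => u * z) z = u * discDeriv P (u * z) :=
  discDeriv_comp (hP.mdifferentiableOn.mdifferentiableAt_of_mem_ball
    (mem_ball_zero_iff.2 (by rwa [norm_mul, hu, one_mul])))
    (by simpa using (hasDerivAt_id z).const_mul u)

/-- The covering is recentred at the point `a` of `exists_discMoebius_pair` and rotated so that the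
deck image of `a` lies at `r`. Having every `r` near `1` available lets two surfaces use the same
`r`. -/
theorem IsHyperbolicRiemannSurface.exists_isDiscCover_identifying [IsManifold 𝓘(ℂ, ℂ) ω Y]
    [CompactSpace Y] (hY : IsHyperbolicRiemannSurface Y) :
    ∃ r₀ : ℝ, 0 < r₀ ∧ r₀ < 1 ∧ ∀ r, r₀ ≤ r → r < 1 → ∃ (P : ℂ → Y) (q : ℂ), IsDiscCover P ∧
      P 0 = P r ∧ discDeriv P 0 = q * discDeriv P r ∧ q ^ 2 ≠ ((1 : ℂ) - r ^ 2) ^ 2 := by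
  obtain ⟨π, α, β, hπ, hα, hβ, hfix, hdeck⟩ := hY.exists_deck
  obtain ⟨r₀, hr₀, hr₀1, H⟩ := exists_discMoebius_pair hα hβ hfix
  refine ⟨r₀, hr₀, hr₀1, fun r hr hr1 => ?_⟩
  obtain ⟨a, ha, hnorm, hq⟩ := H r hr hr1
  have hr0 : 0 < r := hr₀.trans_le hr
  set b := discMoebius α β a with hb
  set b' := discShift (-a) b with hb'
  have hbn : ‖b‖ < 1 := (hdeck a ha).1
  have hbb' : discShift a b' = b := discShift_discShift_neg ha hbn
  have hb'n : ‖b'‖ < 1 := by rwa [hnorm]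
  have hrC : (r : ℂ) ≠ 0 := by exact_mod_cast hr0.ne'
  set u : ℂ := b' / r with hu
  have hu1 : ‖u‖ = 1 := by
    rw [hu, norm_div, hnorm, Complex.norm_real, Real.norm_eq_abs, abs_of_pos hr0, div_self hr0.ne']
  have hur : u * r = b' := div_mul_cancel₀ _ hrC
  have hrn : ‖(r : ℂ)‖ < 1 := by
    rwa [Complex.norm_real, Real.norm_eq_abs, abs_of_pos hr0]
  have h1 := hπ.comp_discShift ha
  have hφ : discDeriv π a
      = (1 - conj β * β) / (conj β * a + conj α) ^ 2 * discDeriv π b := by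
    have hd := hasDerivAt_discMoebius hα hβ ha.le
    rw [hb, ← discDeriv_comp (hπ.mdifferentiableOn.mdifferentiableAt_of_mem_ball
      (mem_ball_zero_iff.2 hbn)) hd]
    refine discDeriv_congr (hπ.mdifferentiableOn.mdifferentiableAt_of_mem_ball
      (mem_ball_zero_iff.2 ha)) ?_
    filter_upwards [isOpen_ball.mem_nhds (mem_ball_zero_iff.2 ha)] with z hz
    exact ((hdeck z (mem_ball_zero_iff.1 hz)).2).symm
  refine ⟨_, _, h1.comp_rotation hu1, ?_, ?_, hq⟩
  · simp only [Function.comp_apply, mul_zero, discShift_zero, hur, hbb']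
    exact (hdeck a ha).2.symm
  · rw [discDeriv_comp_rotation h1 hu1 (by simp), discDeriv_comp_rotation h1 hu1 hrn, mul_zero, hur,
      discDeriv_comp_discShift hπ ha (by simp), discDeriv_comp_discShift hπ ha hb'n,
      discShift_zero, hbb', hφ]
    have hne : 1 + conj a * b' ≠ 0 := one_add_conj_mul_ne_zero ha hb'n.le
    field_simp
    simp

/-- Precompose with the involution `z ↦ discShift r (-z)`, which exchanges `0` and `r` and has
derivatives `-(1 - r²)` at `0` and `-1 / (1 - r²)` at `r`. -/
theorem IsDiscCover.exists_swap {P : ℂ → Y} (hP : IsDiscCover P) {r : ℝ} (hr0 : 0 < r)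
    (hr1 : r < 1) (hPr : P 0 = P r) {q : ℂ} (hq : discDeriv P 0 = q * discDeriv P r) :
    ∃ Q : ℂ → Y, IsDiscCover Q ∧ Q 0 = Q r ∧
      q * discDeriv Q 0 = ((1 : ℂ) - r ^ 2) ^ 2 * discDeriv Q r := by
  have hrn : ‖(r : ℂ)‖ < 1 := by
    rwa [Complex.norm_real, Real.norm_eq_abs, abs_of_pos hr0]
  have hm : ‖(-1 : ℂ)‖ = 1 := by simp
  have h1 := hP.comp_discShift hrn
  have hmr : ‖-(r : ℂ)‖ < 1 := by simpa using hrn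
  have hs : discShift (r : ℂ) (-r) = 0 := by simp [discShift]
  refine ⟨_, h1.comp_rotation hm, ?_, ?_⟩
  · simp [hs, hPr]
  · rw [discDeriv_comp_rotation h1 hm (by simp), discDeriv_comp_rotation h1 hm hrn, mul_zero,
      neg_one_mul (r : ℂ), discDeriv_comp_discShift hP hrn (by simp),
      discDeriv_comp_discShift hP hrn hmr, discShift_zero, hs, hq]
    have hne := one_sub_conj_mul_self_ne_zero hrn
    have hc : conj (r : ℂ) = r := Complex.conj_ofReal r
    rw [hc] at *
    have h2 : (1 : ℂ) + r * -r = 1 - r * r := by ring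
    rw [h2]
    field_simp
    ring

end Pairs

/-! ### Discs in the product -/

section Product

variable {Y₁ Y₂ : Type*} [TopologicalSpace Y₁] [ChartedSpace ℂ Y₁]
  [TopologicalSpace Y₂] [ChartedSpace ℂ Y₂]

theorem mfderiv_prod_eq_discDeriv {f₁ : ℂ → Y₁} {f₂ : ℂ → Y₂} {z : ℂ}
    (h₁ : MDifferentiableAt 𝓘(ℂ, ℂ) 𝓘(ℂ, ℂ) f₁ z) (h₂ : MDifferentiableAt 𝓘(ℂ, ℂ) 𝓘(ℂ, ℂ) f₂ z) :
    (mfderiv 𝓘(ℂ, ℂ) (𝓘(ℂ, ℂ).prod 𝓘(ℂ, ℂ)) (fun z => (f₁ z, f₂ z)) z (1 : ℂ) : ℂ × ℂ) =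
      (discDeriv f₁ z, discDeriv f₂ z) := by
  rw [mfderiv_prodMk h₁ h₂]
  rfl

theorem discDeriv_eq_of_tangentMap_eq {f₁ P₁ : ℂ → Y₁} {f₂ P₂ : ℂ → Y₂} {l : ℝ}
    (hf₁ : MDifferentiableAt 𝓘(ℂ, ℂ) 𝓘(ℂ, ℂ) f₁ 0) (hf₂ : MDifferentiableAt 𝓘(ℂ, ℂ) 𝓘(ℂ, ℂ) f₂ 0)
    (hP₁ : MDifferentiableAt 𝓘(ℂ, ℂ) 𝓘(ℂ, ℂ) P₁ 0) (hP₂ : MDifferentiableAt 𝓘(ℂ, ℂ) 𝓘(ℂ, ℂ) P₂ 0)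
    {p : TangentBundle (𝓘(ℂ, ℂ).prod 𝓘(ℂ, ℂ)) (Y₁ × Y₂)}
    (hp : p = tangentMap 𝓘(ℂ, ℂ) (𝓘(ℂ, ℂ).prod 𝓘(ℂ, ℂ)) (fun z => (P₁ z, P₂ z)) ⟨0, (1 : ℂ)⟩)
    (h : tangentMap 𝓘(ℂ, ℂ) (𝓘(ℂ, ℂ).prod 𝓘(ℂ, ℂ)) (fun z => (f₁ z, f₂ z)) ⟨0, (1 : ℂ)⟩ =
      ⟨p.1, (l : ℂ) • p.2⟩) :
    f₁ 0 = P₁ 0 ∧ f₂ 0 = P₂ 0 ∧ discDeriv f₁ 0 = l * discDeriv P₁ 0 ∧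
      discDeriv f₂ 0 = l * discDeriv P₂ 0 := by
  subst hp
  have h0 : (f₁ 0, f₂ 0) = (P₁ 0, P₂ 0) :=
    congrArg (fun q : TangentBundle (𝓘(ℂ, ℂ).prod 𝓘(ℂ, ℂ)) (Y₁ × Y₂) => q.1) h
  have h1 : (mfderiv 𝓘(ℂ, ℂ) (𝓘(ℂ, ℂ).prod 𝓘(ℂ, ℂ)) (fun z => (f₁ z, f₂ z)) 0 (1 : ℂ) : ℂ × ℂ) =
      (l : ℂ) • (mfderiv 𝓘(ℂ, ℂ) (𝓘(ℂ, ℂ).prod 𝓘(ℂ, ℂ)) (fun z => (P₁ z, P₂ z)) 0 (1 : ℂ) : ℂ × ℂ) :=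
    congrArg (fun q : TangentBundle (𝓘(ℂ, ℂ).prod 𝓘(ℂ, ℂ)) (Y₁ × Y₂) => (q.2 : ℂ × ℂ)) h
  rw [mfderiv_prod_eq_discDeriv hf₁ hf₂, mfderiv_prod_eq_discDeriv hP₁ hP₂] at h1
  exact ⟨congrArg Prod.fst h0, congrArg Prod.snd h0, congrArg Prod.fst h1, congrArg Prod.snd h1⟩

variable [IsManifold 𝓘(ℂ, ℂ) ω Y₁] [IsManifold 𝓘(ℂ, ℂ) ω Y₂]

/-- The components lift to `g` and `k`, both close to the identity because `l` is close to `1`;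
`hdet` is the transversality that makes the double point of `(P₁, P₂)` persist. -/
theorem IsDiscCover.exists_pos_forall_not_injOn {P₁ : ℂ → Y₁} {P₂ : ℂ → Y₂}
    (hP₁ : IsDiscCover P₁) (hP₂ : IsDiscCover P₂) {r : ℝ} (hr0 : 0 < r) (hr1 : r < 1)
    (h₁ : P₁ 0 = P₁ r) (h₂ : P₂ 0 = P₂ r)
    (hdet : discDeriv P₁ 0 * discDeriv P₂ r - discDeriv P₁ r * discDeriv P₂ 0 ≠ 0) :
    ∃ δ > 0, δ < 1 ∧ ∀ (l : ℝ) (f₁ : ℂ → Y₁) (f₂ : ℂ → Y₂), 1 - δ ≤ l →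
      MDifferentiableOn 𝓘(ℂ, ℂ) 𝓘(ℂ, ℂ) f₁ (ball 0 1) →
      MDifferentiableOn 𝓘(ℂ, ℂ) 𝓘(ℂ, ℂ) f₂ (ball 0 1) →
      f₁ 0 = P₁ 0 → f₂ 0 = P₂ 0 → discDeriv f₁ 0 = l * discDeriv P₁ 0 →
      discDeriv f₂ 0 = l * discDeriv P₂ 0 → ¬ InjOn (fun z => (f₁ z, f₂ z)) (ball 0 1) := by
  have h0b : (0 : ℂ) ∈ ball (0 : ℂ) 1 := by simp
  have hrn : ‖(r : ℂ)‖ = r := by rw [Complex.norm_real, Real.norm_eq_abs, abs_of_pos hr0]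
  have hrb : (r : ℂ) ∈ ball (0 : ℂ) 1 := by rwa [mem_ball_zero_iff, hrn]
  set c₁ := chartAt ℂ (P₁ 0) with hc₁
  set c₂ := chartAt ℂ (P₂ 0) with hc₂
  -- Inside `W` both components stay in the chart domains, so a coincidence in coordinates is one on
  -- the surfaces.
  set W : Set ℂ := ball 0 1 ∩ (P₁ ⁻¹' c₁.source ∩ P₂ ⁻¹' c₂.source) with hW
  have hWn : ∀ z ∈ ball (0 : ℂ) 1, P₁ z = P₁ 0 → P₂ z = P₂ 0 → W ∈ 𝓝 z := by
    intro z hz e1 e2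
    refine inter_mem (isOpen_ball.mem_nhds hz) (inter_mem ?_ ?_)
    · refine (hP₁.mdifferentiableOn.mdifferentiableAt_of_mem_ball hz).continuousAt
        (c₁.open_source.mem_nhds ?_)
      rw [e1]
      exact mem_chart_source ℂ _
    · refine (hP₂.mdifferentiableOn.mdifferentiableAt_of_mem_ball hz).continuousAt
        (c₂.open_source.mem_nhds ?_)
      rw [e2]
      exact mem_chart_source ℂ _
  -- The estimate for `g z - z` degenerates at the unit circle; on the ball of radius `R`, which
  -- contains `0` and `r`, it is uniform.
  set R := (1 + r) / 2 with hR
  have hR1 : R < 1 := by rw [hR]; linarith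
  have hRr : r < R := by rw [hR]; linarith
  -- Balls of radius `r / 2` about `0` and `r` are disjoint, which keeps the two coincident
  -- parameters apart.
  have hr2 : 0 < r / 2 := by positivity
  obtain ⟨η, hη, H⟩ := exists_common_coincidence_near_id
    (hasStrictDerivAt_chartAt_comp hP₁.mdifferentiableOn h0b rfl)
    (hasStrictDerivAt_chartAt_comp hP₁.mdifferentiableOn hrb h₁.symm)
    (hasStrictDerivAt_chartAt_comp hP₂.mdifferentiableOn h0b rfl)
    (hasStrictDerivAt_chartAt_comp hP₂.mdifferentiableOn hrb h₂.symm)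
    (by simp only [Function.comp_apply, ← h₁]) (by simp only [Function.comp_apply, ← h₂]) hdet
    (S := ball 0 R) (isOpen_ball.mem_nhds (by rw [mem_ball_zero_iff, norm_zero]; linarith))
    (isOpen_ball.mem_nhds (by rwa [mem_ball_zero_iff, hrn]))
    (inter_mem (hWn 0 h0b rfl rfl) (ball_mem_nhds 0 hr2))
    (inter_mem (hWn r hrb h₁.symm h₂.symm) (ball_mem_nhds (r : ℂ) hr2))
  have hR1' : 0 < 1 - R := by linarith
  -- The second term gives `4 * δ / (1 - R) ≤ η`; the first keeps `δ` below `1`.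
  refine ⟨min (1 / 2) (η * (1 - R) / 4), by positivity, by
    exact (min_le_left _ _).trans_lt (by norm_num), ?_⟩
  intro l f₁ f₂ hl hf₁ hf₂ hf₁0 hf₂0 hd₁ hd₂ hinj
  set δ := min (1 / 2) (η * (1 - R) / 4) with hδ
  have hδ0 : 0 < δ := by positivity
  have near_id : ∀ g : ℂ → ℂ, DifferentiableOn ℂ g (ball 0 1) → MapsTo g (ball 0 1) (ball 0 1) →
      g 0 = 0 → deriv g 0 = l → ∀ z ∈ ball (0 : ℂ) R, ‖g z - z‖ ≤ η := by
    intro g hg hgm hg0 hgl z hz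
    have hzR : ‖z‖ < R := mem_ball_zero_iff.1 hz
    refine (norm_sub_self_le_of_deriv_near_one hg hgm hg0 hgl hδ0 hl
      (mem_ball_zero_iff.2 (hzR.trans hR1))).trans ?_
    rw [div_le_iff₀ (by linarith)]
    have h4 : δ ≤ η * (1 - R) / 4 := min_le_right _ _
    nlinarith
  obtain ⟨g, hg, hgm, hg0, hgf⟩ := hP₁.exists_lift f₁ hf₁ 0 h0b 0 h0b hf₁0.symm
  obtain ⟨k, hk, hkm, hk0, hkf⟩ := hP₂.exists_lift f₂ hf₂ 0 h0b 0 h0b hf₂0.symm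
  have hgl : deriv g 0 = l := by
    have h3 := discDeriv_comp (P := P₁) (h := g) (z := 0)
      (by rw [hg0]; exact hP₁.mdifferentiableOn.mdifferentiableAt_of_mem_ball h0b)
      (hg.differentiableAt (isOpen_ball.mem_nhds h0b)).hasDerivAt
    rw [hg0, ← discDeriv_congr (hf₁.mdifferentiableAt_of_mem_ball h0b) (by
      filter_upwards [isOpen_ball.mem_nhds h0b] with z hz using (hgf z hz).symm), hd₁] at h3
    exact (mul_right_cancel₀ (hP₁.discDeriv_ne_zero 0 h0b) h3).symm
  have hkl : deriv k 0 = l := by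
    have h3 := discDeriv_comp (P := P₂) (h := k) (z := 0)
      (by rw [hk0]; exact hP₂.mdifferentiableOn.mdifferentiableAt_of_mem_ball h0b)
      (hk.differentiableAt (isOpen_ball.mem_nhds h0b)).hasDerivAt
    rw [hk0, ← discDeriv_congr (hf₂.mdifferentiableAt_of_mem_ball h0b) (by
      filter_upwards [isOpen_ball.mem_nhds h0b] with z hz using (hkf z hz).symm), hd₂] at h3
    exact (mul_right_cancel₀ (hP₂.discDeriv_ne_zero 0 h0b) h3).symm
  have hsub : ball (0 : ℂ) R ⊆ ball 0 1 := ball_subset_ball hR1.le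
  obtain ⟨z, hz, w, hw, hgz, hkz, hgw, hkw, e₁, e₂⟩ := H g k (hg.mono hsub) (hk.mono hsub)
    (near_id g hg hgm hg0 hgl) (near_id k hk hkm hk0 hkl)
  have e₁' : P₁ (g z) = P₁ (g w) := c₁.injOn hgz.1.2.1 hgw.1.2.1 e₁
  have e₂' : P₂ (k z) = P₂ (k w) := c₂.injOn hkz.1.2.2 hkw.1.2.2 e₂
  rw [hgf z hz.1.1, hgf w hw.1.1] at e₁'
  rw [hkf z hz.1.1, hkf w hw.1.1] at e₂'
  have hzw : z = w := hinj hz.1.1 hw.1.1 (Prod.ext e₁' e₂')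
  have d1 := mem_ball.1 hz.2
  have d2 := mem_ball.1 hw.2
  rw [← hzw] at d2
  have d3 := dist_triangle_left (r : ℂ) 0 z
  rw [dist_zero_right, hrn] at d3
  linarith

theorem kobayashiMetric_ne_injectiveKobayashiMetric_of_isDiscCover {P₁ : ℂ → Y₁} {P₂ : ℂ → Y₂}
    (hP₁ : IsDiscCover P₁) (hP₂ : IsDiscCover P₂) {r : ℝ} (hr0 : 0 < r) (hr1 : r < 1)
    (h₁ : P₁ 0 = P₁ r) (h₂ : P₂ 0 = P₂ r)
    (hdet : discDeriv P₁ 0 * discDeriv P₂ r - discDeriv P₁ r * discDeriv P₂ 0 ≠ 0) :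
    kobayashiMetric (𝓘(ℂ, ℂ).prod 𝓘(ℂ, ℂ)) (Y₁ × Y₂) ≠
      injectiveKobayashiMetric (𝓘(ℂ, ℂ).prod 𝓘(ℂ, ℂ)) (Y₁ × Y₂) := by
  intro heq
  have h0b : (0 : ℂ) ∈ ball (0 : ℂ) 1 := by simp
  obtain ⟨δ, hδ, hδ1, H⟩ := hP₁.exists_pos_forall_not_injOn hP₂ hr0 hr1 h₁ h₂ hdet
  set p : TangentBundle (𝓘(ℂ, ℂ).prod 𝓘(ℂ, ℂ)) (Y₁ × Y₂) :=
    tangentMap 𝓘(ℂ, ℂ) (𝓘(ℂ, ℂ).prod 𝓘(ℂ, ℂ)) (fun z => (P₁ z, P₂ z)) ⟨0, (1 : ℂ)⟩ with hp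
  have hK : kobayashiMetric (𝓘(ℂ, ℂ).prod 𝓘(ℂ, ℂ)) (Y₁ × Y₂) p ≤ 1 := by
    refine sInf_le ⟨1, fun z => (P₁ z, P₂ z), one_pos,
      hP₁.mdifferentiableOn.prodMk hP₂.mdifferentiableOn, trivial, ?_, by simp⟩
    rw [Complex.ofReal_one, one_smul]
  have hI : ENNReal.ofReal (1 / (1 - δ)) ≤
      injectiveKobayashiMetric (𝓘(ℂ, ℂ).prod 𝓘(ℂ, ℂ)) (Y₁ × Y₂) p := by
    refine le_sInf ?_
    rintro _ ⟨l, f, hl, hf, hinj, hft, rfl⟩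
    refine ENNReal.ofReal_le_ofReal (one_div_le_one_div_of_le hl ?_)
    by_contra! hlt
    have hf₁ : MDifferentiableOn 𝓘(ℂ, ℂ) 𝓘(ℂ, ℂ) (fun z => (f z).1) (ball 0 1) :=
      mdifferentiable_fst.comp_mdifferentiableOn hf
    have hf₂ : MDifferentiableOn 𝓘(ℂ, ℂ) 𝓘(ℂ, ℂ) (fun z => (f z).2) (ball 0 1) :=
      mdifferentiable_snd.comp_mdifferentiableOn hf
    obtain ⟨e₁, e₂, d₁, d₂⟩ := discDeriv_eq_of_tangentMap_eq
      (hf₁.mdifferentiableAt_of_mem_ball h0b) (hf₂.mdifferentiableAt_of_mem_ball h0b)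
      (hP₁.mdifferentiableOn.mdifferentiableAt_of_mem_ball h0b)
      (hP₂.mdifferentiableOn.mdifferentiableAt_of_mem_ball h0b) hp hft
    exact H l _ _ hlt.le hf₁ hf₂ e₁ e₂ d₁ d₂ hinj
  rw [← heq] at hI
  have h1 : (1 : ℝ≥0∞) < ENNReal.ofReal (1 / (1 - δ)) := by
    rw [ENNReal.one_lt_ofReal, lt_div_iff₀ (by linarith)]
    linarith
  exact absurd (h1.trans_le (hI.trans hK)) (lt_irrefl _)

end Product

end

/-! ### Choice of the two coverings -/

theorem mainTheorem5 {Y₁ Y₂ : Type*}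
    [TopologicalSpace Y₁] [T2Space Y₁] [CompactSpace Y₁] [ConnectedSpace Y₁]
    [ChartedSpace ℂ Y₁] [IsManifold 𝓘(ℂ, ℂ) ω Y₁]
    [TopologicalSpace Y₂] [T2Space Y₂] [CompactSpace Y₂] [ConnectedSpace Y₂]
    [ChartedSpace ℂ Y₂] [IsManifold 𝓘(ℂ, ℂ) ω Y₂]
    (h₁ : IsHyperbolicRiemannSurface Y₁) (h₂ : IsHyperbolicRiemannSurface Y₂) :
    kobayashiMetric (𝓘(ℂ, ℂ).prod 𝓘(ℂ, ℂ)) (Y₁ × Y₂) ≠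
      injectiveKobayashiMetric (𝓘(ℂ, ℂ).prod 𝓘(ℂ, ℂ)) (Y₁ × Y₂) := by
  obtain ⟨r₁, hr₁, hr₁1, H₁⟩ := h₁.exists_isDiscCover_identifying
  obtain ⟨r₂, hr₂, hr₂1, H₂⟩ := h₂.exists_isDiscCover_identifying
  set r := max r₁ r₂ with hr
  have hr0 : 0 < r := hr₁.trans_le (le_max_left _ _)
  have hr1 : r < 1 := max_lt hr₁1 hr₂1
  have hrb : (r : ℂ) ∈ Metric.ball (0 : ℂ) 1 := by
    rwa [mem_ball_zero_iff, Complex.norm_real, Real.norm_eq_abs, abs_of_pos hr0]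
  obtain ⟨P₁, q₁, hP₁, hPr₁, hd₁, hq₁⟩ := H₁ r (le_max_left _ _) hr1
  obtain ⟨P₂, q₂, hP₂, hPr₂, hd₂, -⟩ := H₂ r (le_max_right _ _) hr1
  -- The crossing is transversal exactly when the ratios differ. If they agree, the swap replaces
  -- the second by `(1 - r²)² / q₁`, which equals `q₁` only if `q₁² = (1 - r²)²`, against `hq₁`.
  by_cases hq : q₁ = q₂
  · obtain ⟨Q, hQ, hQr, hQd⟩ := hP₂.exists_swap hr0 hr1 hPr₂ hd₂
    refine kobayashiMetric_ne_injectiveKobayashiMetric_of_isDiscCover hP₁ hQ hr0 hr1 hPr₁ hQr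
      fun hdet => ?_
    have h3 : discDeriv P₁ r * discDeriv Q r * (q₁ ^ 2 - ((1 : ℂ) - r ^ 2) ^ 2) = 0 := by
      rw [← hq] at hQd
      rw [hd₁] at hdet
      linear_combination q₁ * hdet + discDeriv P₁ r * hQd
    exact mul_ne_zero (mul_ne_zero (hP₁.discDeriv_ne_zero _ hrb) (hQ.discDeriv_ne_zero _ hrb))
      (sub_ne_zero.2 hq₁) h3
  · refine kobayashiMetric_ne_injectiveKobayashiMetric_of_isDiscCover hP₁ hP₂ hr0 hr1 hPr₁ hPr₂ ?_
    have h3 : discDeriv P₁ 0 * discDeriv P₂ r - discDeriv P₁ r * discDeriv P₂ 0 =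
        discDeriv P₁ r * discDeriv P₂ r * (q₁ - q₂) := by
      rw [hd₁, hd₂]; ring
    rw [h3]
    exact mul_ne_zero (mul_ne_zero (hP₁.discDeriv_ne_zero _ hrb) (hP₂.discDeriv_ne_zero _ hrb))
      (sub_ne_zero.2 hq)
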